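/- Let $G$ be a locally compact (Hausdorff) group and let $H\subseteq G$ be a closed subgroup. Write $\mathrm{URep}(G)$ for the category whose objects are the strongly continuous unitary representations of $G$ on complex Hilbert spaces and whose morphisms are the bounded $G$-equivariant linear operators, and similarly for $H$. Let $\mathrm{Res}^G_H:\mathrm{URep}(G)\to\mathrm{URep}(H)$ be restriction. Let $\mu$ be any strongly quasi-invariant Radon measure on $G/H$ (a nonzero Radon measure with $d\mu(gp)=\lambda(g,p)\,d\mu(p)$ for a jointly continuous strictly positive function $\lambda$ on $G\times G/H$). Let $\mathrm{Ind}_H^G:\mathrm{URep}(H)\to\mathrm{URep}(G)$ be Mackey's unitary induction functor, realised with $\mu$: $\mathrm{Ind}_H^G X$ is the completion of the space of continuous functions $f:G\to X$ with $f(xh)=h^{-1}f(x)$ for $h\in H$ that are supported on a set with relatively compact image in $G/H$, for the inner product $\int_{G/H}\langle f(x),f'(x)\rangle\,d\mu(xH)$, with $G$ acting by $(gf)(x)=\lambda(g^{-1},xH)^{1/2}f(g^{-1}x)$, and with morphisms acting by composition on values. Let $L^2(G/H)=L^2(G/H,\mu)$ be the quasi-regular representation, $(gf)(p)=\lambda(g^{-1},p)^{1/2}f(g^{-1}p)$.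 (a) If the functor $\mathrm{Ind}_H^G$ has a left adjoint or a right adjoint, then $L^2(G/H)$ is unitarily equivalent to a finite direct sum of irreducible unitary representations of $G$. (b) If the functor $\mathrm{Res}^G_H$ has a left adjoint or a right adjoint, then $$\sum_{Y\in\widehat G}\dim Y^H<\infty,$$ where $\widehat G$ is the set of unitary equivalence classes of irreducible unitary representations of $G$ and $Y^H$ is the space of $H$-fixed vectors in $Y$. -/

import Mathlib

open CategoryTheory MeasureTheory
open scoped ENNReal InnerProductSpace

universe u

set_option linter.unusedSectionVars false

noncomputable section

/-- A (strongly continuous) unitary representation of a topological group `G`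
on a complex Hilbert space. -/
structure URep (G : Type u) [Group G] [TopologicalSpace G] where
  /-- the underlying Hilbert space -/
  V : Type u
  [instNormed : NormedAddCommGroup V]
  [instInner : InnerProductSpace ℂ V]
  [instComplete : CompleteSpace V]
  /-- the action by unitary operators -/
  ρ : G →* (V ≃ₗᵢ[ℂ] V)
  continuous_ρ : ∀ v : V, Continuous fun g : G => ρ g v

namespace URep

attribute [instance] URep.instNormed URep.instInner URep.instComplete

section Category

variable {G : Type u} [Group G] [TopologicalSpace G]

/-- Morphisms of unitary representations: bounded `G`-equivariant linear operators. -/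
@[ext]
structure Hom (X Y : URep G) where
  /-- the underlying bounded operator -/
  toCLM : X.V →L[ℂ] Y.V
  comm : ∀ (g : G) (v : X.V), toCLM (X.ρ g v) = Y.ρ g (toCLM v)

instance : Category (URep G) where
  Hom X Y := Hom X Y
  id X := ⟨ContinuousLinearMap.id ℂ X.V, fun _ _ => rfl⟩
  comp S T := ⟨T.toCLM.comp S.toCLM, fun g v => by
    simp [S.comm, T.comm]⟩

/-- Unitary equivalence of representations. -/
def UnitaryEquiv (X Y : URep G) : Prop :=
  ∃ U : X.V ≃ₗᵢ[ℂ] Y.V, ∀ (g : G) (v : X.V), U (X.ρ g v) = Y.ρ g (U v)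

theorem UnitaryEquiv.refl (X : URep G) : UnitaryEquiv X X :=
  ⟨LinearIsometryEquiv.refl ℂ X.V, fun _ _ => rfl⟩

theorem UnitaryEquiv.symm {X Y : URep G} (h : UnitaryEquiv X Y) : UnitaryEquiv Y X := by
  obtain ⟨U, hU⟩ := h
  refine ⟨U.symm, fun g v => ?_⟩
  apply U.injective
  rw [hU]
  simp

theorem UnitaryEquiv.trans {X Y Z : URep G} (h : UnitaryEquiv X Y) (h' : UnitaryEquiv Y Z) :
    UnitaryEquiv X Z := by
  obtain ⟨U, hU⟩ := h
  obtain ⟨W, hW⟩ := h'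
  exact ⟨U.trans W, fun g v => by simp [hU, hW]⟩

/-- Irreducibility: the space is nonzero, and `0` and the whole space are the only closed
invariant subspaces. -/
def IsIrreducible (X : URep G) : Prop :=
  Nontrivial X.V ∧ ∀ W : Submodule ℂ X.V, IsClosed (W : Set X.V) →
    (∀ (g : G), ∀ w ∈ W, X.ρ g w ∈ W) → W = ⊥ ∨ W = ⊤

/-- The Hilbert-space direct sum of finitely many unitary representations. -/
def directSum {ι : Type} [Fintype ι] (Y : ι → URep G) : URep G where
  V := PiLp 2 fun i => (Y i).V
  ρ :=
    { toFun := fun g => LinearIsometryEquiv.piLpCongrRight 2 fun i => (Y i).ρ g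
      map_one' := by ext v; simp
      map_mul' := fun g h => by ext v; simp }
  continuous_ρ := fun v => by
    refine (PiLp.continuous_toLp 2 _).comp (continuous_pi fun i => ?_)
    exact (Y i).continuous_ρ (v i)

/-- Unitary equivalence as an equivalence relation on the irreducible representations. -/
def irrepSetoid (G : Type u) [Group G] [TopologicalSpace G] :
    Setoid {Y : URep G // Y.IsIrreducible} where
  r Y Z := UnitaryEquiv Y.1 Z.1
  iseqv := ⟨fun Y => .refl Y.1, fun h => h.symm, fun h h' => h.trans h'⟩

/-- The unitary dual of `G`: equivalence classes of irreducible unitary representations. -/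
def Dual (G : Type u) [Group G] [TopologicalSpace G] : Type (u + 1) :=
  Quotient (irrepSetoid G)

/-- The space of `H`-fixed vectors in a representation of `G`. -/
def fixedVectors (H : Subgroup G) (X : URep G) : Submodule ℂ X.V where
  carrier := {v | ∀ h ∈ H, X.ρ h v = v}
  zero_mem' := fun h _ => map_zero _
  add_mem' := fun {v w} hv hw h hh => by rw [map_add, hv h hh, hw h hh]
  smul_mem' := fun c v hv h hh => by rw [map_smul, hv h hh]

/-- The dimension (a natural number or `∞`) of the space of `H`-fixed vectors. -/
def fixedDim (H : Subgroup G) (X : URep G) : ℕ∞ :=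
  Cardinal.toENat (Module.rank ℂ (fixedVectors H X))

theorem fixedDim_congr (H : Subgroup G) {X Y : URep G} (h : UnitaryEquiv X Y) :
    fixedDim H X = fixedDim H Y := by
  obtain ⟨U, hU⟩ := h
  have key : (fixedVectors H X).map U.toLinearEquiv.toLinearMap = fixedVectors H Y := by
    ext w
    constructor
    · rintro ⟨v, hv, rfl⟩ h hh
      have := hU h v
      rw [hv h hh] at this
      exact this.symm
    · intro hw
      refine ⟨U.symm w, fun h hh => ?_, by simp⟩
      apply U.injective
      rw [hU]
      simpa using hw h hh
  have e := LinearEquiv.submoduleMap U.toLinearEquiv (fixedVectors H X)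
  unfold fixedDim
  rw [← key]
  exact congrArg _ e.rank_eq

/-- `dim Y^H` for a class `Y` in the unitary dual. -/
def Dual.fixedDim (H : Subgroup G) (Y : Dual G) : ℕ∞ :=
  Quotient.lift (s := irrepSetoid G) (fun Z => URep.fixedDim H Z.1)
    (fun _ _ h => fixedDim_congr H h) Y

/-- The restriction functor from unitary representations of `G` to those of a subgroup `H`. -/
def Res (H : Subgroup G) : URep G ⥤ URep H where
  obj X :=
    { V := X.V
      ρ := X.ρ.comp H.subtype
      continuous_ρ := fun v => (X.continuous_ρ v).comp continuous_subtype_val }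
  map T := ⟨T.toCLM, fun h v => T.comm h v⟩

end Category

section Build

variable {G : Type u} [Group G]

/-- A multiplicative family of linear isometries, as a homomorphism into the unitary group. -/
def isometryAction {V : Type u} [NormedAddCommGroup V] [InnerProductSpace ℂ V]
    (a : G → V →ₗᵢ[ℂ] V) (h1 : ∀ v, a 1 v = v) (hm : ∀ g h v, a (g * h) v = a g (a h v)) :
    G →* (V ≃ₗᵢ[ℂ] V) where
  toFun g :=
    { toLinearEquiv :=
        { (a g).toLinearMap with
          invFun := a g⁻¹
          left_inv := fun v => by
            change a g⁻¹ (a g v) = v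
            rw [← hm, inv_mul_cancel, h1]
          right_inv := fun v => by
            change a g (a g⁻¹ v) = v
            rw [← hm, mul_inv_cancel, h1] }
      norm_map' := fun v => (a g).norm_map v }
  map_one' := by ext v; exact h1 v
  map_mul' g h := by ext v; exact hm g h v

@[simp] theorem isometryAction_apply {V : Type u} [NormedAddCommGroup V] [InnerProductSpace ℂ V]
    (a : G → V →ₗᵢ[ℂ] V) (h1 : ∀ v, a 1 v = v) (hm : ∀ g h v, a (g * h) v = a g (a h v))
    (g : G) (v : V) : isometryAction a h1 hm g v = a g v := rfl

/-- An isometric action that is strongly continuous on a dense set is strongly continuous. -/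
theorem continuous_of_dense [TopologicalSpace G] [IsTopologicalGroup G] {V : Type u}
    [NormedAddCommGroup V] [InnerProductSpace ℂ V] (a : G →* (V ≃ₗᵢ[ℂ] V)) (D : Set V)
    (hD : Dense D) (hc : ∀ v ∈ D, Continuous fun g => a g v) (v : V) :
    Continuous fun g => a g v := by
  refine continuous_iff_continuousAt.2 fun g₀ => Metric.continuousAt_iff'.2 fun ε hε => ?_
  obtain ⟨w, hw, hvw⟩ := Metric.dense_iff.1 hD v (ε / 3) (by positivity)
  have := Metric.continuousAt_iff'.1 ((hc w hvw).continuousAt (x := g₀)) (ε / 3) (by positivity)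
  filter_upwards [this] with g hg
  have h1 : dist (a g v) (a g w) < ε / 3 := by
    rw [(a g).dist_map, dist_comm]; exact hw
  have h2 : dist (a g₀ w) (a g₀ v) < ε / 3 := by
    rw [(a g₀).dist_map]; exact hw
  calc dist (a g v) (a g₀ v) ≤ dist (a g v) (a g w) + dist (a g w) (a g₀ w)
        + dist (a g₀ w) (a g₀ v) := dist_triangle4 _ _ _ _
    _ < ε := by linarith

end Build

end URep

/-- A strongly quasi-invariant measure on `G ⧸ H`: a nonzero Radon measure `μ` together with a
jointly continuous, strictly positive family of densities `density g = dμ_g / dμ`, where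
`μ_g E = μ (g E)`. -/
structure QuasiInvariantMeasure {G : Type u} [Group G] [TopologicalSpace G]
    (H : Subgroup G) [MeasurableSpace (G ⧸ H)] where
  /-- the measure on the homogeneous space -/
  μ : Measure (G ⧸ H)
  regular : μ.Regular
  ne_zero : μ ≠ 0
  /-- the Radon-Nikodym derivative of the translate `E ↦ μ (g E)` with respect to `μ` -/
  density : G → G ⧸ H → ℝ
  density_pos : ∀ g p, 0 < density g p
  continuous_density : Continuous fun z : G × (G ⧸ H) => density z.1 z.2
  apply_smul : ∀ (g : G) (E : Set (G ⧸ H)), MeasurableSet E →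
    μ ((fun p => g • p) '' E) = ∫⁻ p in E, ENNReal.ofReal (density g p) ∂μ

namespace QuasiInvariantMeasure

variable {G : Type u} [Group G] [TopologicalSpace G] [IsTopologicalGroup G]
  [LocallyCompactSpace G] {H : Subgroup G} [MeasurableSpace (G ⧸ H)] [BorelSpace (G ⧸ H)]
  (Q : QuasiInvariantMeasure H)

attribute [instance] QuasiInvariantMeasure.regular

theorem continuous_density_right (g : G) : Continuous (Q.density g) :=
  Q.continuous_density.comp (Continuous.prodMk_right g)

theorem map_eq (g : G) : Q.μ.map (fun p => g • p) =
    Q.μ.withDensity fun p => ENNReal.ofReal (Q.density g⁻¹ p) := by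
  ext E hE
  rw [withDensity_apply _ hE, ← Q.apply_smul _ _ hE,
    Measure.map_apply (continuous_const_smul g).measurable hE]
  congr 1
  exact (Set.preimage_smul g E).trans rfl

theorem lintegral_smul (g : G) (F : G ⧸ H → ℝ≥0∞) :
    ∫⁻ p, ENNReal.ofReal (Q.density g⁻¹ p) * F (g⁻¹ • p) ∂Q.μ = ∫⁻ p, F p ∂Q.μ := by
  have hd : Measurable fun p => ENNReal.ofReal (Q.density g⁻¹ p) :=
    (Q.continuous_density_right g⁻¹).measurable.ennreal_ofReal
  have h1 := lintegral_withDensity_eq_lintegral_mul_non_measurable Q.μ hd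
    (Filter.Eventually.of_forall fun p => ENNReal.ofReal_lt_top) (fun p => F (g⁻¹ • p))
  simp only [Pi.mul_apply] at h1
  rw [← h1, ← Q.map_eq g]
  exact ((Homeomorph.smul g : (G ⧸ H) ≃ₜ (G ⧸ H)).measurableEmbedding.lintegral_map _).trans
    (by simp)

theorem integral_smul {E : Type*} [NormedAddCommGroup E] [NormedSpace ℝ E] (g : G)
    (F : G ⧸ H → E) :
    ∫ p, Q.density g⁻¹ p • F (g⁻¹ • p) ∂Q.μ = ∫ p, F p ∂Q.μ := by
  have hd : Measurable fun p => (Q.density g⁻¹ p).toNNReal :=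
    (Q.continuous_density_right g⁻¹).measurable.real_toNNReal
  have h1 := integral_withDensity_eq_integral_smul (μ := Q.μ) hd (fun p => F (g⁻¹ • p))
  have h2 : ∀ p, (Q.density g⁻¹ p).toNNReal • F (g⁻¹ • p)
      = Q.density g⁻¹ p • F (g⁻¹ • p) := fun p => by
    rw [NNReal.smul_def, Real.coe_toNNReal _ (Q.density_pos _ _).le]
  simp only [h2] at h1
  rw [← h1]
  change ∫ a, F (g⁻¹ • a) ∂(Q.μ.withDensity fun p => ENNReal.ofReal (Q.density g⁻¹ p)) = _
  rw [← Q.map_eq g]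
  exact ((Homeomorph.smul g : (G ⧸ H) ≃ₜ (G ⧸ H)).measurableEmbedding.integral_map _).trans
    (by simp)

theorem image_smul_null (g : G) {E : Set (G ⧸ H)} (hE : MeasurableSet E) (h : Q.μ E = 0) :
    Q.μ ((fun p => g • p) '' E) = 0 := by
  rw [Q.apply_smul g E hE]
  exact setLIntegral_measure_zero _ _ h

/-- A quasi-invariant measure has full support. -/
theorem eq_empty_of_isOpen {U : Set (G ⧸ H)} (hU : IsOpen U) (h : Q.μ U = 0) : U = ∅ := by
  by_contra hne
  obtain ⟨p₀, hp₀⟩ := Set.nonempty_iff_ne_empty.2 hne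
  apply Q.ne_zero
  have hK : ∀ K : Set (G ⧸ H), IsCompact K → Q.μ K = 0 := by
    intro K hK
    refine hK.measure_zero_of_nhdsWithin fun p _ => ?_
    obtain ⟨g, rfl⟩ := MulAction.exists_smul_eq G p₀ p
    refine ⟨(fun p => g • p) '' U, mem_nhdsWithin_of_mem_nhds ?_,
      Q.image_smul_null g hU.measurableSet h⟩
    exact ((Homeomorph.smul g : (G ⧸ H) ≃ₜ (G ⧸ H)).isOpenMap U hU).mem_nhds ⟨p₀, hp₀, rfl⟩
  rw [← Measure.measure_univ_eq_zero]
  rw [isOpen_univ.measure_eq_iSup_isCompact]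
  simp only [ENNReal.iSup_eq_zero]
  exact fun K _ hKc => hK K hKc

theorem continuous_eq_of_setLIntegral_eq {a b : G ⧸ H → ℝ} (ha : Continuous a)
    (hb : Continuous b) (hb0 : ∀ p, 0 < b p)
    (hab : ∀ E, MeasurableSet E →
      ∫⁻ p in E, ENNReal.ofReal (a p) ∂Q.μ = ∫⁻ p in E, ENNReal.ofReal (b p) ∂Q.μ) (p : G ⧸ H) :
    a p ≤ b p := by
  by_contra! hlt
  obtain ⟨c, hbc, hca⟩ := exists_between hlt
  have hc0 : 0 < c := (hb0 p).trans hbc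
  have : IsLocallyFiniteMeasure Q.μ := isLocallyFiniteMeasure_of_isFiniteMeasureOnCompacts
  obtain ⟨W, hWp, hWμ⟩ := Q.μ.exists_isOpen_measure_lt_top p |>.imp fun W h =>
    (⟨⟨h.1, h.2.1⟩, h.2.2⟩ : (p ∈ W ∧ IsOpen W) ∧ Q.μ W < ∞)
  set U := W ∩ ({q | b q < c} ∩ {q | c < a q}) with hU
  have hUo : IsOpen U :=
    hWp.2.inter ((isOpen_lt hb continuous_const).inter (isOpen_lt continuous_const ha))
  have hUp : p ∈ U := ⟨hWp.1, hbc, hca⟩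
  have hUfin : Q.μ U < ∞ := (measure_mono Set.inter_subset_left).trans_lt hWμ
  have hU0 : Q.μ U ≠ 0 := fun h => by
    have := Q.eq_empty_of_isOpen hUo h
    rw [this] at hUp
    exact hUp
  have hmeas := hUo.measurableSet
  have h1 : ∫⁻ q in U, ENNReal.ofReal (b q) ∂Q.μ < ENNReal.ofReal c * Q.μ U := by
    rw [← setLIntegral_const]
    refine setLIntegral_strict_mono hmeas hU0 measurable_const ?_ ?_
    · refine ne_of_lt ?_
      refine (setLIntegral_mono (g := fun _ => ENNReal.ofReal c) measurable_const
        fun q hq => ENNReal.ofReal_le_ofReal hq.2.1.le).trans_lt ?_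
      rw [setLIntegral_const]
      exact ENNReal.mul_lt_top ENNReal.ofReal_lt_top hUfin
    · exact Filter.Eventually.of_forall fun q hq =>
        (ENNReal.ofReal_lt_ofReal_iff hc0).2 hq.2.1
  have h2 : ENNReal.ofReal c * Q.μ U ≤ ∫⁻ q in U, ENNReal.ofReal (a q) ∂Q.μ := by
    rw [← setLIntegral_const]
    exact setLIntegral_mono ha.measurable.ennreal_ofReal
      fun q hq => ENNReal.ofReal_le_ofReal hq.2.2.le
  exact absurd (hab U hmeas) (h1.trans_le h2).ne'

theorem eq_of_setLIntegral_eq {a b : G ⧸ H → ℝ} (ha : Continuous a)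
    (hb : Continuous b) (ha0 : ∀ p, 0 < a p) (hb0 : ∀ p, 0 < b p)
    (hab : ∀ E, MeasurableSet E →
      ∫⁻ p in E, ENNReal.ofReal (a p) ∂Q.μ = ∫⁻ p in E, ENNReal.ofReal (b p) ∂Q.μ) (p : G ⧸ H) :
    a p = b p :=
  le_antisymm (Q.continuous_eq_of_setLIntegral_eq ha hb hb0 hab p)
    (Q.continuous_eq_of_setLIntegral_eq hb ha ha0 (fun E hE => (hab E hE).symm) p)

theorem density_one (p : G ⧸ H) : Q.density 1 p = 1 := by
  refine Q.eq_of_setLIntegral_eq (Q.continuous_density_right 1) continuous_const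
    (Q.density_pos 1) (fun _ => one_pos) (fun E hE => ?_) p
  rw [← Q.apply_smul 1 E hE]
  simp

theorem density_mul (g h : G) (p : G ⧸ H) :
    Q.density (g * h) p = Q.density g (h • p) * Q.density h p := by
  have hc : Continuous fun p => Q.density g (h • p) :=
    (Q.continuous_density_right g).comp (continuous_const_smul h)
  refine Q.eq_of_setLIntegral_eq (Q.continuous_density_right (g * h))
    (hc.mul (Q.continuous_density_right h)) (Q.density_pos _)
    (fun p => mul_pos (Q.density_pos _ _) (Q.density_pos _ _)) (fun E hE => ?_) p
  have hhE : MeasurableSet ((fun p => h • p) '' E) :=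
    (Homeomorph.smul h : (G ⧸ H) ≃ₜ (G ⧸ H)).measurableEmbedding.measurableSet_image.2 hE
  have key := Q.lintegral_smul h⁻¹
    (((fun p => h • p) '' E).indicator fun p => ENNReal.ofReal (Q.density g p))
  rw [lintegral_indicator hhE, ← Q.apply_smul g _ hhE, Set.image_image] at key
  simp only [← mul_smul, inv_inv] at key
  rw [← Q.apply_smul _ E hE, ← key, ← lintegral_indicator hE]
  refine lintegral_congr fun q => ?_
  by_cases hq : q ∈ E
  · have : h • q ∈ (fun p => h • p) '' E := ⟨q, hq, rfl⟩
    rw [Set.indicator_of_mem this, Set.indicator_of_mem hq, mul_comm,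
      ← ENNReal.ofReal_mul (Q.density_pos _ _).le]
    rfl
  · have : h • q ∉ (fun p => h • p) '' E := by
      rintro ⟨q', hq', e⟩
      exact hq (MulAction.injective h e ▸ hq')
    rw [Set.indicator_of_notMem this, Set.indicator_of_notMem hq, mul_zero]

/-- The normalising factor in the action of `G` on half-densities. -/
def weight (g : G) (p : G ⧸ H) : ℝ := Real.sqrt (Q.density g⁻¹ p)

theorem weight_one (p : G ⧸ H) : Q.weight 1 p = 1 := by
  simp [weight, density_one]

theorem weight_mul (g h : G) (p : G ⧸ H) :
    Q.weight (g * h) p = Q.weight g p * Q.weight h (g⁻¹ • p) := by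
  unfold weight
  rw [mul_inv_rev, Q.density_mul, mul_comm, Real.sqrt_mul (Q.density_pos _ _).le]

theorem weight_sq (g : G) (p : G ⧸ H) : Q.weight g p * Q.weight g p = Q.density g⁻¹ p :=
  Real.mul_self_sqrt (Q.density_pos _ _).le

theorem continuous_weight : Continuous fun z : G × (G ⧸ H) => Q.weight z.1 z.2 :=
  (Q.continuous_density.comp (continuous_fst.inv.prodMk continuous_snd)).sqrt

theorem continuous_weight_right (g : G) : Continuous (Q.weight g) :=
  Q.continuous_weight.comp (Continuous.prodMk_right g)

end QuasiInvariantMeasure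

/-! ### Unitary induction -/

section Induction

variable {G : Type u} [Group G] [TopologicalSpace G] [IsTopologicalGroup G]
  [LocallyCompactSpace G] {H : Subgroup G}

/-- Continuous functions `f : G → X` with `f (x h) = h⁻¹ f(x)` for `h ∈ H`, whose support has
relatively compact image in `G ⧸ H`. -/
def inducedSections (X : URep H) : Submodule ℂ (G → X.V) where
  carrier := {f | Continuous f ∧ (∀ (x : G) (h : H), f (x * h) = X.ρ h⁻¹ (f x)) ∧
    ∃ K : Set (G ⧸ H), IsCompact K ∧ ∀ x : G, (x : G ⧸ H) ∉ K → f x = 0}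
  zero_mem' := ⟨continuous_const, fun x h => by simp, ∅, isCompact_empty, fun _ _ => rfl⟩
  add_mem' := by
    rintro f g ⟨hf, hfe, K, hK, hfK⟩ ⟨hg, hge, L, hL, hgL⟩
    refine ⟨hf.add hg, fun x h => by simp [hfe, hge], K ∪ L, hK.union hL, fun x hx => ?_⟩
    rw [Set.mem_union, not_or] at hx
    simp [hfK x hx.1, hgL x hx.2]
  smul_mem' := by
    rintro c f ⟨hf, hfe, K, hK, hfK⟩
    exact ⟨hf.const_smul c, fun x h => by simp [hfe], K, hK, fun x hx => by simp [hfK x hx]⟩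

/-- The pointwise inner product of two sections, as a function on `G ⧸ H`. -/
def sectionInner {X : URep H} (f g : inducedSections X) : G ⧸ H → ℂ :=
  fun p => Quotient.liftOn' p (fun x : G => ⟪f.1 x, g.1 x⟫_ℂ) fun x y hxy => by
    obtain ⟨h, rfl⟩ : ∃ h : H, y = x * h :=
      ⟨⟨x⁻¹ * y, QuotientGroup.leftRel_apply.1 hxy⟩, by simp⟩
    rw [f.2.2.1, g.2.2.1, LinearIsometryEquiv.inner_map_map]

@[simp] theorem sectionInner_mk {X : URep H} (f g : inducedSections X) (x : G) :
    sectionInner f g (x : G ⧸ H) = ⟪f.1 x, g.1 x⟫_ℂ := rfl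

theorem continuous_sectionInner {X : URep H} (f g : inducedSections X) :
    Continuous (sectionInner f g) :=
  QuotientGroup.isOpenQuotientMap_mk.continuous_comp_iff.1 (f.2.1.inner g.2.1)

theorem sectionInner_eq_zero {X : URep H} (f g : inducedSections X) {K : Set (G ⧸ H)}
    (hK : ∀ x : G, (x : G ⧸ H) ∉ K → g.1 x = 0) (p : G ⧸ H) (hp : p ∉ K) :
    sectionInner f g p = 0 := by
  induction p using QuotientGroup.induction_on with
  | H x => rw [sectionInner_mk, hK x hp, inner_zero_right]

variable [IsClosed (H : Set G)] [MeasurableSpace (G ⧸ H)] [BorelSpace (G ⧸ H)]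

/-- The space of compactly supported continuous sections, equipped below with the inner product
`⟨f, g⟩ = ∫_{G/H} ⟨f(x), g(x)⟩ dμ(xH)`. -/
def PreInduced (_Q : QuasiInvariantMeasure H) (X : URep H) : Type u := inducedSections (G := G) X

namespace PreInduced

variable (Q : QuasiInvariantMeasure H) (X : URep H)

instance : AddCommGroup (PreInduced Q X) := inferInstanceAs (AddCommGroup (inducedSections X))
instance : Module ℂ (PreInduced Q X) := inferInstanceAs (Module ℂ (inducedSections X))

variable {Q X}

theorem integrable (f g : PreInduced Q X) : Integrable (sectionInner f g) Q.μ := by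
  obtain ⟨K, hK, hgK⟩ := g.2.2.2
  rw [← integrableOn_iff_integrable_of_support_subset (s := closure K)]
  · exact (continuous_sectionInner f g).continuousOn.integrableOn_compact hK.closure
  · intro p hp
    by_contra hpK
    exact hp (sectionInner_eq_zero f g hgK p fun h => hpK (subset_closure h))

variable (Q X)

instance core : PreInnerProductSpace.Core ℂ (PreInduced Q X) where
  inner f g := ∫ p, sectionInner f g p ∂Q.μ
  conj_inner_symm f g := by
    change (starRingEnd ℂ) (∫ p, sectionInner g f p ∂Q.μ) = ∫ p, sectionInner f g p ∂Q.μ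
    rw [← integral_conj]
    refine integral_congr_ae (Filter.Eventually.of_forall fun p => ?_)
    induction p using QuotientGroup.induction_on with
    | H x => exact inner_conj_symm _ _
  re_inner_nonneg f := by
    rw [← integral_re (integrable f f)]
    refine integral_nonneg fun p => ?_
    induction p using QuotientGroup.induction_on with
    | H x => exact inner_self_nonneg
  add_left f g k := by
    change ∫ p, sectionInner (f + g) k p ∂Q.μ =
      ∫ p, sectionInner f k p ∂Q.μ + ∫ p, sectionInner g k p ∂Q.μ
    rw [← integral_add (integrable f k) (integrable g k)]
    refine integral_congr_ae (Filter.Eventually.of_forall fun p => ?_)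
    induction p using QuotientGroup.induction_on with
    | H x => exact inner_add_left _ _ _
  smul_left f g c := by
    change ∫ p, sectionInner (c • f) g p ∂Q.μ = (starRingEnd ℂ) c * ∫ p, sectionInner f g p ∂Q.μ
    rw [← integral_const_mul]
    refine integral_congr_ae (Filter.Eventually.of_forall fun p => ?_)
    induction p using QuotientGroup.induction_on with
    | H x => exact inner_smul_left _ _ _

instance : SeminormedAddCommGroup (PreInduced Q X) :=
  InnerProductSpace.Core.toSeminormedAddCommGroup (𝕜 := ℂ)

instance : InnerProductSpace ℂ (PreInduced Q X) := InnerProductSpace.ofCore (core Q X)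

variable {Q X}

theorem inner_def (f g : PreInduced Q X) : ⟪f, g⟫_ℂ = ∫ p, sectionInner f g p ∂Q.μ := rfl

/-- The squared pointwise norm of a section, as a function on `G ⧸ H`. -/
theorem norm_sq_eq (f : PreInduced Q X) : ‖f‖ ^ 2 = ∫ p, RCLike.re (sectionInner f f p) ∂Q.μ := by
  rw [integral_re (integrable f f)]
  exact InnerProductSpace.norm_sq_eq_re_inner (𝕜 := ℂ) f

/-- The action of `G`: `(g f)(x) = (dμ(g⁻¹ xH) / dμ(xH)) ^ (1/2) f (g⁻¹ x)`. -/
def act (g : G) : PreInduced Q X →ₗ[ℂ] PreInduced Q X where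
  toFun f := ⟨fun x => (Q.weight g (x : G ⧸ H) : ℂ) • f.1 (g⁻¹ * x), by
    obtain ⟨hf, hfe, K, hK, hfK⟩ := f.2
    refine ⟨?_, fun x h => ?_, (fun p => g • p) '' K, hK.image (continuous_const_smul g),
      fun x hx => ?_⟩
    · exact (Complex.continuous_ofReal.comp ((Q.continuous_weight_right g).comp
        QuotientGroup.continuous_mk)).smul (hf.comp (continuous_const_mul g⁻¹))
    · have : ((x * h : G) : G ⧸ H) = (x : G ⧸ H) := QuotientGroup.mk_mul_of_mem x h.2
      change (Q.weight g ((x * h : G) : G ⧸ H) : ℂ) • f.1 (g⁻¹ * (x * h)) =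
        X.ρ h⁻¹ ((Q.weight g (x : G ⧸ H) : ℂ) • f.1 (g⁻¹ * x))
      rw [this, map_smul, ← hfe, mul_assoc]
    · change (Q.weight g (x : G ⧸ H) : ℂ) • f.1 (g⁻¹ * x) = 0
      rw [hfK (g⁻¹ * x), smul_zero]
      intro hmem
      refine hx ⟨_, hmem, ?_⟩
      change ((g * (g⁻¹ * x) : G) : G ⧸ H) = x
      rw [mul_inv_cancel_left]⟩
  map_add' f f' := Subtype.ext (funext fun x => smul_add _ _ _)
  map_smul' c f := Subtype.ext (funext fun x => smul_comm _ _ _)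

theorem act_apply (g : G) (f : PreInduced Q X) (x : G) :
    (act g f).1 x = (Q.weight g (x : G ⧸ H) : ℂ) • f.1 (g⁻¹ * x) := rfl

theorem sectionInner_act (g : G) (f f' : PreInduced Q X) (p : G ⧸ H) :
    sectionInner (act g f) (act g f') p = Q.density g⁻¹ p • sectionInner f f' (g⁻¹ • p) := by
  induction p using QuotientGroup.induction_on with
  | H x =>
    change ⟪(act g f).1 x, (act g f').1 x⟫_ℂ =
      Q.density g⁻¹ (x : G ⧸ H) • ⟪f.1 (g⁻¹ * x), f'.1 (g⁻¹ * x)⟫_ℂ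
    rw [act_apply, act_apply, inner_smul_left, inner_smul_right, Complex.conj_ofReal,
      ← mul_assoc, ← Complex.ofReal_mul, Q.weight_sq, Complex.real_smul]

theorem norm_act (g : G) (f : PreInduced Q X) : ‖act g f‖ = ‖f‖ := by
  have h : ⟪act g f, act g f⟫_ℂ = ⟪f, f⟫_ℂ := by
    rw [inner_def, inner_def]
    simp only [sectionInner_act]
    exact Q.integral_smul g _
  rw [inner_self_eq_norm_sq_to_K, inner_self_eq_norm_sq_to_K] at h
  have h' : ‖act g f‖ ^ 2 = ‖f‖ ^ 2 := by exact_mod_cast h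
  exact (sq_eq_sq₀ (norm_nonneg _) (norm_nonneg _)).1 h'

theorem act_one (f : PreInduced Q X) : act 1 f = f :=
  Subtype.ext (funext fun x => by rw [act_apply, Q.weight_one]; simp)

theorem act_mul (g h : G) (f : PreInduced Q X) : act (g * h) f = act g (act h f) :=
  Subtype.ext (funext fun x => by
    rw [act_apply, act_apply, act_apply, Q.weight_mul, smul_smul, Complex.ofReal_mul,
      mul_inv_rev, mul_assoc]
    rfl)

theorem continuous_act (f : PreInduced Q X) : Continuous fun g : G => act g f := by
  rw [continuous_iff_continuousAt]
  intro g₀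
  obtain ⟨N, hN, hNg⟩ := exists_compact_mem_nhds g₀
  obtain ⟨K, hK, hfK⟩ := f.2.2.2
  set L : Set (G ⧸ H) := (fun z : G × (G ⧸ H) => z.1 • z.2) '' (N ×ˢ K) with hL
  have hLc : IsCompact L := (hN.prod hK).image continuous_smul
  have hzero : ∀ g ∈ N, ∀ x : G, (x : G ⧸ H) ∉ L → (act g f).1 x = 0 := by
    intro g hg x hx
    rw [act_apply, hfK, smul_zero]
    intro hmem
    refine hx ⟨(g, ((g⁻¹ * x : G) : G ⧸ H)), ⟨hg, hmem⟩, ?_⟩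
    change ((g * (g⁻¹ * x) : G) : G ⧸ H) = x
    rw [mul_inv_cancel_left]
  have hcont : ContinuousOn (fun g : G =>
      ∫ p, sectionInner (act g f - act g₀ f) (act g f - act g₀ f) p ∂Q.μ) N := by
    refine continuousOn_integral_of_compact_support hLc (Continuous.continuousOn ?_) ?_
    · have hq : IsOpenQuotientMap (Prod.map id (QuotientGroup.mk : G → G ⧸ H) : G × G → _) :=
        IsOpenQuotientMap.id.prodMap QuotientGroup.isOpenQuotientMap_mk
      rw [← hq.continuous_comp_iff]
      have h1 : Continuous fun z : G × G => (act z.1 f - act g₀ f).1 z.2 := by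
        change Continuous fun z : G × G => (act z.1 f).1 z.2 - (act g₀ f).1 z.2
        refine Continuous.sub ?_ ((act g₀ f).2.1.comp continuous_snd)
        simp only [act_apply]
        refine Continuous.smul (Complex.continuous_ofReal.comp (Q.continuous_weight.comp
          (continuous_fst.prodMk (QuotientGroup.continuous_mk.comp continuous_snd)))) ?_
        exact f.2.1.comp (continuous_fst.inv.mul continuous_snd)
      exact h1.inner h1
    · intro g p hg hp
      refine sectionInner_eq_zero _ _ (K := L) (fun x hx => ?_) p hp
      change (act g f).1 x - (act g₀ f).1 x = 0
      rw [hzero g hg x hx, hzero g₀ (mem_of_mem_nhds hNg) x hx, sub_zero]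
  have h2 : ContinuousAt (fun g : G => ‖act g f - act g₀ f‖) g₀ := by
    have h3 : ∀ g : G, ‖act g f - act g₀ f‖ = Real.sqrt (RCLike.re
        (∫ p, sectionInner (act g f - act g₀ f) (act g f - act g₀ f) p ∂Q.μ)) := fun g => by
      rw [← inner_def, ← InnerProductSpace.norm_sq_eq_re_inner, Real.sqrt_sq (norm_nonneg _)]
    simp only [h3]
    exact Real.continuous_sqrt.continuousAt.comp
      (RCLike.continuous_re.continuousAt.comp (hcont.continuousAt hNg))
  rw [ContinuousAt, tendsto_iff_norm_sub_tendsto_zero]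
  simpa [ContinuousAt] using h2

/-- Post-composition of sections with a morphism. -/
def map {X Y : URep H} (T : URep.Hom X Y) : PreInduced Q X →L[ℂ] PreInduced Q Y :=
  LinearMap.mkContinuous
    { toFun := fun f => ⟨fun x => T.toCLM (f.1 x), by
        obtain ⟨hf, hfe, K, hK, hfK⟩ := f.2
        exact ⟨T.toCLM.continuous.comp hf, 
          fun x h => (congrArg T.toCLM (hfe x h)).trans (T.comm _ _), K, hK,
          fun x hx => (congrArg T.toCLM (hfK x hx)).trans (map_zero _)⟩⟩
      map_add' := fun f f' => Subtype.ext (funext fun x => map_add _ _ _)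
      map_smul' := fun c f => Subtype.ext (funext fun x => map_smul _ _ _) }
    ‖T.toCLM‖ fun f => by
      refine abs_le_of_sq_le_sq' ?_ (by positivity) |>.2
      rw [mul_pow, norm_sq_eq, norm_sq_eq, ← integral_const_mul]
      refine integral_mono (integrable _ _).re ((integrable f f).re.const_mul _) fun p => ?_
      induction p using QuotientGroup.induction_on with
      | H x =>
        change RCLike.re ⟪T.toCLM (f.1 x), T.toCLM (f.1 x)⟫_ℂ ≤
          ‖T.toCLM‖ ^ 2 * RCLike.re ⟪f.1 x, f.1 x⟫_ℂ
        rw [← InnerProductSpace.norm_sq_eq_re_inner, ← InnerProductSpace.norm_sq_eq_re_inner,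
          ← mul_pow]
        gcongr
        exact T.toCLM.le_opNorm _

theorem map_apply {X Y : URep H} (T : URep.Hom X Y) (f : PreInduced Q X) (x : G) :
    (map T f).1 x = T.toCLM (f.1 x) := rfl

theorem map_act {X Y : URep H} (T : URep.Hom X Y) (g : G) (f : PreInduced Q X) :
    map T (act g f) = act g (map T f) :=
  Subtype.ext (funext fun x => by
    rw [map_apply, act_apply, act_apply, map_apply, map_smul])

end PreInduced

open UniformSpace in
/-- The extension of the action to the completion. -/
def completionAct (Q : QuasiInvariantMeasure H) (X : URep H) (g : G) :
    Completion (PreInduced Q X) →ₗᵢ[ℂ] Completion (PreInduced Q X) where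
  toLinearMap := (ContinuousLinearMap.completion
    (LinearMap.mkContinuous (PreInduced.act (Q := Q) (X := X) g) 1
      fun f => by rw [PreInduced.norm_act, one_mul])).toLinearMap
  norm_map' v := by
    induction v using UniformSpace.Completion.induction_on with
    | hp => exact isClosed_eq (ContinuousLinearMap.continuous _).norm continuous_norm
    | ih f =>
      simp [PreInduced.norm_act]

open UniformSpace in
@[simp] theorem completionAct_coe (Q : QuasiInvariantMeasure H) (X : URep H) (g : G)
    (f : PreInduced Q X) :
    completionAct Q X g (f : Completion (PreInduced Q X)) = (PreInduced.act g f : PreInduced Q X) :=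
  ContinuousLinearMap.completion_apply_coe _ f

open UniformSpace in
/-- The representation of `G` unitarily induced from a representation `X` of `H`. -/
def URep.induced (Q : QuasiInvariantMeasure H) (X : URep H) : URep G where
  V := Completion (PreInduced Q X)
  ρ := URep.isometryAction (completionAct Q X)
    (fun v => by
      induction v using UniformSpace.Completion.induction_on with
      | hp => exact isClosed_eq (completionAct Q X 1).continuous continuous_id
      | ih f => rw [completionAct_coe, PreInduced.act_one])
    (fun g h v => by
      induction v using UniformSpace.Completion.induction_on with
      | hp =>
        exact isClosed_eq (completionAct Q X (g * h)).continuous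
          ((completionAct Q X g).continuous.comp (completionAct Q X h).continuous)
      | ih f => rw [completionAct_coe, completionAct_coe, completionAct_coe, PreInduced.act_mul])
  continuous_ρ := by
    refine URep.continuous_of_dense _ _ (Completion.denseRange_coe (α := PreInduced Q X)) ?_
    rintro _ ⟨f, rfl⟩
    simp only [URep.isometryAction_apply, completionAct_coe]
    exact (Completion.continuous_coe _).comp (PreInduced.continuous_act f)

open UniformSpace in
/-- Mackey's unitary induction functor from unitary representations of `H` to those of `G`,
realised with the quasi-invariant measure `Q`. -/
def URep.Ind (Q : QuasiInvariantMeasure H) : URep H ⥤ URep G where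
  obj X := URep.induced Q X
  map {X Y} T :=
    { toCLM := (PreInduced.map (Q := Q) T).completion
      comm := fun g v => by
        change (PreInduced.map (Q := Q) T).completion (completionAct Q X g v) =
          completionAct Q Y g ((PreInduced.map (Q := Q) T).completion v)
        induction v using UniformSpace.Completion.induction_on with
        | hp =>
          exact isClosed_eq
            ((ContinuousLinearMap.continuous _).comp (completionAct Q X g).continuous)
            ((completionAct Q Y g).continuous.comp (ContinuousLinearMap.continuous _))
        | ih f => simp [PreInduced.map_act] }
  map_id X := URep.Hom.ext <| ContinuousLinearMap.ext fun v => by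
    change (PreInduced.map (Q := Q) (𝟙 X : URep.Hom X X)).completion v = v
    induction v using UniformSpace.Completion.induction_on with
    | hp => exact isClosed_eq (ContinuousLinearMap.continuous _) continuous_id
    | ih f => rw [ContinuousLinearMap.completion_apply_coe]; rfl
  map_comp {X Y Z} S T := URep.Hom.ext <| ContinuousLinearMap.ext fun v => by
    change (PreInduced.map (Q := Q) (S ≫ T : URep.Hom X Z)).completion v =
      (PreInduced.map (Q := Q) T).completion ((PreInduced.map (Q := Q) S).completion v)
    induction v using UniformSpace.Completion.induction_on with
    | hp =>
      exact isClosed_eq (ContinuousLinearMap.continuous _)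
        ((ContinuousLinearMap.continuous _).comp (ContinuousLinearMap.continuous _))
    | ih f =>
      rw [ContinuousLinearMap.completion_apply_coe, ContinuousLinearMap.completion_apply_coe,
        ContinuousLinearMap.completion_apply_coe]
      rfl

/-! ### The quasi-regular representation -/

namespace QuasiInvariantMeasure

variable (Q : QuasiInvariantMeasure H)

theorem quasiMeasurePreserving_smul (g : G) :
    Measure.QuasiMeasurePreserving (fun p : G ⧸ H => g • p) Q.μ Q.μ :=
  ⟨(continuous_const_smul g).measurable, by
    rw [Q.map_eq]
    exact withDensity_absolutelyContinuous _ _⟩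

/-- Translation of functions on `G ⧸ H`, with the normalising factor. -/
def translate (g : G) (f : G ⧸ H → ℂ) : G ⧸ H → ℂ := fun p => (Q.weight g p : ℂ) * f (g⁻¹ • p)

theorem translate_congr (g : G) {f f' : G ⧸ H → ℂ} (h : f =ᵐ[Q.μ] f') :
    Q.translate g f =ᵐ[Q.μ] Q.translate g f' := by
  filter_upwards [(Q.quasiMeasurePreserving_smul g⁻¹).ae h] with p hp
  simp only [translate, hp]

theorem eLpNorm_translate (g : G) (f : G ⧸ H → ℂ) :
    eLpNorm (Q.translate g f) 2 Q.μ = eLpNorm f 2 Q.μ := by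
  rw [eLpNorm_eq_lintegral_rpow_enorm_toReal (by norm_num) (by norm_num),
    eLpNorm_eq_lintegral_rpow_enorm_toReal (by norm_num) (by norm_num)]
  congr 1
  rw [← Q.lintegral_smul g fun p => ‖f p‖ₑ ^ (2 : ℝ≥0∞).toReal]
  refine lintegral_congr fun p => ?_
  have h0 : 0 ≤ Q.weight g p := Real.sqrt_nonneg _
  rw [translate, enorm_mul, ENNReal.mul_rpow_of_nonneg _ _ (by norm_num)]
  congr 1
  rw [← Q.weight_sq, ENNReal.ofReal_mul h0]
  have : ‖(Q.weight g p : ℂ)‖ₑ = ENNReal.ofReal (Q.weight g p) := by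
    rw [← ofReal_norm, Complex.norm_real, Real.norm_of_nonneg h0]
  rw [this]
  norm_num [sq]

theorem memLp_translate (g : G) {f : G ⧸ H → ℂ} (hf : MemLp f 2 Q.μ) :
    MemLp (Q.translate g f) 2 Q.μ := by
  refine ⟨?_, by rw [Q.eLpNorm_translate]; exact hf.2⟩
  exact (Complex.continuous_ofReal.comp (Q.continuous_weight_right g)).aestronglyMeasurable.mul
    (hf.1.comp_quasiMeasurePreserving (Q.quasiMeasurePreserving_smul g⁻¹))

/-- The unitary translation operators on `L²(G ⧸ H, μ)`. -/
def translateLp (g : G) : Lp ℂ 2 Q.μ →ₗᵢ[ℂ] Lp ℂ 2 Q.μ where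
  toFun f := (Q.memLp_translate g (Lp.memLp f)).toLp _
  map_add' f f' := by
    rw [← MemLp.toLp_add, MemLp.toLp_eq_toLp_iff]
    refine (Q.translate_congr g (Lp.coeFn_add f f')).trans (Filter.Eventually.of_forall fun p => ?_)
    simp [translate, mul_add]
  map_smul' c f := by
    rw [RingHom.id_apply, ← MemLp.toLp_const_smul, MemLp.toLp_eq_toLp_iff]
    refine (Q.translate_congr g (Lp.coeFn_smul c f)).trans
      (Filter.Eventually.of_forall fun p => ?_)
    simp [translate, mul_left_comm]
  norm_map' f := by
    change ‖(Q.memLp_translate g (Lp.memLp f)).toLp _‖ = ‖f‖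
    rw [Lp.norm_toLp, Q.eLpNorm_translate, Lp.norm_def]

theorem translateLp_apply (g : G) (f : Lp ℂ 2 Q.μ) :
    Q.translateLp g f = (Q.memLp_translate g (Lp.memLp f)).toLp _ := rfl

theorem translateLp_toLp (g : G) {f : G ⧸ H → ℂ} (hf : MemLp f 2 Q.μ) :
    Q.translateLp g (hf.toLp f) = (Q.memLp_translate g hf).toLp _ := by
  rw [translateLp_apply, MemLp.toLp_eq_toLp_iff]
  exact Q.translate_congr g hf.coeFn_toLp

theorem translate_one (f : G ⧸ H → ℂ) : Q.translate 1 f = f := by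
  ext p; simp [translate, Q.weight_one]

theorem translate_mul (g h : G) (f : G ⧸ H → ℂ) :
    Q.translate (g * h) f = Q.translate g (Q.translate h f) := by
  ext p
  simp only [translate, Q.weight_mul, mul_inv_rev, mul_smul, Complex.ofReal_mul, mul_assoc]

theorem continuous_translateLp {f : G ⧸ H → ℂ} (hf : MemLp f 2 Q.μ)
    (hc : Continuous f) (hs : HasCompactSupport f) :
    Continuous fun g : G => Q.translateLp g (hf.toLp f) := by
  rw [continuous_iff_continuousAt]
  intro g₀
  obtain ⟨N, hN, hNg⟩ := exists_compact_mem_nhds g₀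
  set L : Set (G ⧸ H) := (fun z : G × (G ⧸ H) => z.1 • z.2) '' (N ×ˢ tsupport f) with hL
  have hLc : IsCompact L := (hN.prod hs).image continuous_smul
  have hzero : ∀ g ∈ N, ∀ p, p ∉ L → Q.translate g f p = 0 := by
    intro g hg p hp
    have h0 : f (g⁻¹ • p) = 0 := image_eq_zero_of_notMem_tsupport fun hmem =>
      hp ⟨(g, g⁻¹ • p), ⟨hg, hmem⟩, by simp⟩
    rw [translate, h0, mul_zero]
  have hjc : Continuous fun z : G × (G ⧸ H) => Q.translate z.1 f z.2 :=
    (Complex.continuous_ofReal.comp Q.continuous_weight).mul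
      (hc.comp (continuous_fst.inv.smul continuous_snd))
  have hcont : ContinuousOn (fun g : G =>
      ∫ p, ‖Q.translate g f p - Q.translate g₀ f p‖ ^ 2 ∂Q.μ) N := by
    refine continuousOn_integral_of_compact_support hLc (Continuous.continuousOn ?_) ?_
    · exact ((hjc.sub (hjc.comp (continuous_const.prodMk continuous_snd))).norm).pow 2
    · intro g p hg hp
      simp [hzero g hg p hp, hzero g₀ (mem_of_mem_nhds hNg) p hp]
  have h3 : ∀ g : G, ‖Q.translateLp g (hf.toLp f) - Q.translateLp g₀ (hf.toLp f)‖ = Real.sqrt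
      (∫ p, ‖Q.translate g f p - Q.translate g₀ f p‖ ^ 2 ∂Q.μ) := fun g => by
    rw [Q.translateLp_toLp, Q.translateLp_toLp, ← MemLp.toLp_sub, Lp.norm_toLp,
      (((Q.memLp_translate g hf).sub (Q.memLp_translate g₀ hf))).eLpNorm_eq_integral_rpow_norm
        (by norm_num) (by norm_num), ENNReal.toReal_ofReal (by positivity), Real.sqrt_eq_rpow]
    norm_num
  have h2 : ContinuousAt (fun g : G =>
      ‖Q.translateLp g (hf.toLp f) - Q.translateLp g₀ (hf.toLp f)‖) g₀ := by
    simp only [h3]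
    exact Real.continuous_sqrt.continuousAt.comp (hcont.continuousAt hNg)
  rw [ContinuousAt, tendsto_iff_norm_sub_tendsto_zero]
  simpa [ContinuousAt] using h2

theorem exists_compactSupport_approx {f : G ⧸ H → ℂ} (hf : MemLp f 2 Q.μ) {ε : ℝ≥0∞}
    (hε : ε ≠ 0) : ∃ k : G ⧸ H → ℂ, eLpNorm (f - k) 2 Q.μ ≤ ε ∧ HasCompactSupport k ∧
      Continuous k ∧ MemLp k 2 Q.μ := by
  refine hf.induction_dense (by norm_num)
    (fun k => HasCompactSupport k ∧ Continuous k ∧ MemLp k 2 Q.μ) ?_ ?_ ?_ hε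
  · intro c t ht htμ ε hε
    obtain ⟨η, ηpos, hη⟩ := exists_eLpNorm_indicator_le (μ := Q.μ) (p := 2) (by norm_num) c hε
    have hη2 : (η / 2 : ℝ≥0∞) ≠ 0 := by
      simpa using ηpos.ne'
    obtain ⟨s, hst, hsc, hscl, hsμ⟩ := ht.exists_isCompact_isClosed_sdiff_lt htμ.ne hη2
    obtain ⟨V, hsV, hVo, _, hVμ⟩ :=
      hscl.measurableSet.exists_isOpen_sdiff_lt (hsc.measure_lt_top (μ := Q.μ)).ne hη2
    obtain ⟨k, hk1, hk0, hkc, hkI⟩ := exists_continuous_one_zero_of_isCompact hsc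
      hVo.isClosed_compl (Set.disjoint_compl_right_iff_subset.2 hsV)
    have hcs : HasCompactSupport fun p => k p • c := hkc.smul_right
    have hcc : Continuous fun p => k p • c := k.continuous.smul continuous_const
    refine ⟨fun p => k p • c, ?_, hcs, hcc, hcc.memLp_of_hasCompactSupport hcs⟩
    refine (eLpNorm_mono fun p => ?_).trans (hη ((t \ s) ∪ (V \ s)) ?_)
    · by_cases hps : p ∈ s
      · simp [hk1 hps, hst hps]
      · by_cases hpV : p ∈ V
        · have hmem : p ∈ (t \ s) ∪ (V \ s) := Or.inr ⟨hpV, hps⟩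
          rw [Set.indicator_of_mem hmem]
          have h0 := (hkI p).1
          have h1 := (hkI p).2
          by_cases hpt : p ∈ t
          · have : k p • c - c = (k p - 1) • c := by rw [sub_smul, one_smul]
            rw [Pi.sub_apply, Set.indicator_of_mem hpt, this, norm_smul]
            refine mul_le_of_le_one_left (norm_nonneg _) ?_
            rw [Real.norm_eq_abs, abs_le]
            constructor <;> linarith
          · rw [Pi.sub_apply, Set.indicator_of_notMem hpt, sub_zero, norm_smul]
            refine mul_le_of_le_one_left (norm_nonneg _) ?_
            rw [Real.norm_eq_abs, abs_le]
            constructor <;> linarith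
        · have hk : k p = 0 := hk0 hpV
          by_cases hpt : p ∈ t
          · have hmem : p ∈ (t \ s) ∪ (V \ s) := Or.inl ⟨hpt, hps⟩
            simp [hk, hpt, hps]
          · simp [hk, hpt]
    · refine (measure_union_le _ _).trans ((add_le_add hsμ.le hVμ.le).trans ?_)
      rw [ENNReal.add_halves]
  · rintro f g ⟨hf, hfc, hfm⟩ ⟨hg, hgc, hgm⟩
    exact ⟨hf.add hg, hfc.add hgc, hfm.add hgm⟩
  · rintro f ⟨-, -, hfm⟩
    exact hfm.1

/-- The quasi-regular representation of `G` on `L²(G ⧸ H, μ)`: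
`(g f)(p) = (dμ(g⁻¹ p) / dμ(p)) ^ (1/2) f (g⁻¹ p)`. -/
def quasiRegular : URep G where
  V := Lp ℂ 2 Q.μ
  ρ := URep.isometryAction Q.translateLp
    (fun f => by
      rw [translateLp_apply]
      simp only [Q.translate_one]
      exact Lp.toLp_coeFn f _)
    (fun g h f => by
      rw [Q.translateLp_apply h, Q.translateLp_toLp, translateLp_apply]
      simp only [Q.translate_mul])
  continuous_ρ := by
    refine URep.continuous_of_dense _
      {v | ∃ (f : G ⧸ H → ℂ) (hf : MemLp f 2 Q.μ), Continuous f ∧ HasCompactSupport f ∧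
        hf.toLp f = v} ?_ ?_
    · rw [Metric.dense_iff]
      intro v r hr
      obtain ⟨k, hkv, hks, hkc, hk⟩ := Q.exists_compactSupport_approx (Lp.memLp v)
        (ε := ENNReal.ofReal (r / 2)) (by simpa using hr)
      refine ⟨hk.toLp k, ?_, k, hk, hkc, hks, rfl⟩
      have h1 : dist v (hk.toLp k) ≤ r / 2 := by
        conv_lhs => rw [← Lp.toLp_coeFn v (Lp.memLp v)]
        rw [dist_eq_norm, ← MemLp.toLp_sub, Lp.norm_toLp]
        exact ENNReal.toReal_le_of_le_ofReal (by positivity) hkv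
      rw [Metric.mem_ball, dist_comm]
      linarith
    · rintro _ ⟨f, hf, hc, hs, rfl⟩
      exact Q.continuous_translateLp hf hc hs

end QuasiInvariantMeasure

end Induction

end

noncomputable section

namespace URep

section Intertwiners

variable {G : Type u} [Group G] [TopologicalSpace G]

/-- The space of bounded equivariant operators between two unitary representations. -/
def intertwiners (X Y : URep G) : Submodule ℂ (X.V →L[ℂ] Y.V) where
  carrier := {T | ∀ g v, T (X.ρ g v) = Y.ρ g (T v)}
  zero_mem' := fun g v => by simp
  add_mem' := fun {S T} hS hT g v => by simp [hS g v, hT g v]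
  smul_mem' := fun c T hT g v => by simp [hT g v]

theorem mem_intertwiners {X Y : URep G} {T : X.V →L[ℂ] Y.V} :
    T ∈ intertwiners X Y ↔ ∀ g v, T (X.ρ g v) = Y.ρ g (T v) := Iff.rfl

theorem isClosed_intertwiners (X Y : URep G) :
    IsClosed (intertwiners X Y : Set (X.V →L[ℂ] Y.V)) := by
  have : (intertwiners X Y : Set (X.V →L[ℂ] Y.V)) =
      ⋂ g, ⋂ v, {T | T (X.ρ g v) = Y.ρ g (T v)} := by
    ext T
    simp [mem_intertwiners]
  rw [this]
  refine isClosed_iInter fun g => isClosed_iInter fun v => isClosed_eq ?_ ?_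
  · exact (ContinuousLinearMap.apply ℂ Y.V (X.ρ g v)).continuous
  · exact (Y.ρ g).continuous.comp (ContinuousLinearMap.apply ℂ Y.V v).continuous

instance (X Y : URep G) : CompleteSpace (intertwiners X Y) :=
  (isClosed_intertwiners X Y).completeSpace_coe

theorem comp_mem_intertwiners {X Y Z : URep G} {S : Y.V →L[ℂ] Z.V} {T : X.V →L[ℂ] Y.V}
    (hS : S ∈ intertwiners Y Z) (hT : T ∈ intertwiners X Y) : S ∘L T ∈ intertwiners X Z :=
  fun g v => by simp [hT g v, hS g (T v)]

theorem ρ_inv_apply (X : URep G) (g : G) (v : X.V) : X.ρ g⁻¹ v = (X.ρ g).symm v := by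
  rw [map_inv]; rfl

theorem inner_ρ_left (X : URep G) (g : G) (v w : X.V) : ⟪X.ρ g v, w⟫_ℂ = ⟪v, X.ρ g⁻¹ w⟫_ℂ := by
  rw [ρ_inv_apply, ← (X.ρ g).inner_map_map v, LinearIsometryEquiv.apply_symm_apply]

theorem adjoint_mem_intertwiners {X Y : URep G} {T : X.V →L[ℂ] Y.V}
    (hT : T ∈ intertwiners X Y) : ContinuousLinearMap.adjoint T ∈ intertwiners Y X := by
  intro g v
  refine ext_inner_right ℂ fun w => ?_
  rw [ContinuousLinearMap.adjoint_inner_left, inner_ρ_left, inner_ρ_left,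
    ContinuousLinearMap.adjoint_inner_left, hT]

theorem isClosed_fixedVectors (H : Subgroup G) (X : URep G) :
    IsClosed (fixedVectors H X : Set X.V) := by
  have : (fixedVectors H X : Set X.V) = ⋂ h ∈ H, {v | X.ρ h v = v} := by
    ext v
    simp [fixedVectors]
  rw [this]
  exact isClosed_biInter fun h _ => isClosed_eq (X.ρ h).continuous continuous_id

instance (H : Subgroup G) (X : URep G) : CompleteSpace (fixedVectors H X) :=
  (isClosed_fixedVectors H X).completeSpace_coe

/-- A closed subspace stable under the group. -/
structure IsClosedInvariant (X : URep G) (F : Submodule ℂ X.V) : Prop where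
  isClosed : IsClosed (F : Set X.V)
  map_mem : ∀ g : G, ∀ v ∈ F, X.ρ g v ∈ F

namespace IsClosedInvariant

variable {X : URep G} {E F : Submodule ℂ X.V}

theorem completeSpace (hF : IsClosedInvariant X F) : CompleteSpace F :=
  hF.isClosed.completeSpace_coe

theorem orthogonal (hF : IsClosedInvariant X F) : IsClosedInvariant X Fᗮ where
  isClosed := F.isClosed_orthogonal
  map_mem g v hv := by
    rw [Submodule.mem_orthogonal'] at hv ⊢
    intro w hw
    rw [inner_ρ_left]
    exact hv _ (hF.map_mem _ w hw)

theorem inf (hE : IsClosedInvariant X E) (hF : IsClosedInvariant X F) :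
    IsClosedInvariant X (E ⊓ F) where
  isClosed := hE.isClosed.inter hF.isClosed
  map_mem g v hv := ⟨hE.map_mem g v hv.1, hF.map_mem g v hv.2⟩

theorem ker {Y : URep G} {T : X.V →L[ℂ] Y.V} (hT : T ∈ intertwiners X Y) :
    IsClosedInvariant X T.ker where
  isClosed := T.isClosed_ker
  map_mem g v hv := by
    rw [LinearMap.mem_ker] at hv ⊢
    change T v = 0 at hv
    change T _ = 0
    rw [hT g v, hv, map_zero]

theorem starProjection_mem (hF : IsClosedInvariant X F) [F.HasOrthogonalProjection] :
    F.starProjection ∈ intertwiners X X := by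
  intro g v
  refine Submodule.eq_starProjection_of_mem_orthogonal (hF.map_mem g _
    (F.starProjection_apply_mem v)) ?_
  rw [← map_sub]
  exact hF.orthogonal.map_mem g _ (F.sub_starProjection_mem_orthogonal v)

/-- The restriction of a representation to a closed invariant subspace. -/
def subrep (hF : IsClosedInvariant X F) : URep G :=
  haveI := hF.completeSpace
  { V := F
    ρ := isometryAction
      (fun g =>
        { toLinearMap := ((X.ρ g).toLinearEquiv.toLinearMap).restrict (hF.map_mem g)
          norm_map' := fun v => (X.ρ g).norm_map v })
      (fun v => Subtype.ext (by
        change X.ρ 1 (v : X.V) = v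
        rw [map_one]; rfl))
      (fun g h v => Subtype.ext (by
        change X.ρ (g * h) (v : X.V) = X.ρ g (X.ρ h (v : X.V))
        rw [map_mul]; rfl))
    continuous_ρ := fun v => Continuous.subtype_mk (X.continuous_ρ (v : X.V)) _ }

theorem subtypeL_mem (hF : IsClosedInvariant X F) :
    (F.subtypeL : hF.subrep.V →L[ℂ] X.V) ∈ intertwiners hF.subrep X := fun _ _ => rfl

theorem isIrreducible_subrep (hF : IsClosedInvariant X F) (h0 : F ≠ ⊥)
    (hmin : ∀ E, IsClosedInvariant X E → E ≤ F → E = ⊥ ∨ E = F) :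
    hF.subrep.IsIrreducible := by
  refine ⟨Submodule.nontrivial_iff_ne_bot.2 h0, fun W hW hWinv => ?_⟩
  have hWinv' : IsClosedInvariant X (Submodule.map F.subtype W) :=
    ⟨hF.isClosed.isClosedEmbedding_subtypeVal.isClosedMap _ hW, by
      rintro g _ ⟨w, hw, rfl⟩
      exact ⟨_, hWinv g w hw, rfl⟩⟩
  rcases hmin _ hWinv' (Submodule.map_subtype_le F W) with h | h
  · left
    refine Submodule.map_injective_of_injective F.injective_subtype ?_
    rw [h]
    exact (Submodule.map_bot F.subtype).symm
  · right
    refine Submodule.map_injective_of_injective F.injective_subtype ?_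
    rw [h]
    exact (Submodule.map_subtype_top F).symm

end IsClosedInvariant

end Intertwiners

section Schur

variable {G : Type u} [Group G] [TopologicalSpace G] {X Y : URep G}

theorem IsIrreducible.eq_algebraMap_of_isSelfAdjoint (hY : Y.IsIrreducible) {A : Y.V →L[ℂ] Y.V}
    (hA : A ∈ intertwiners Y Y) (hs : IsSelfAdjoint A) :
    ∃ r : ℝ, A = algebraMap ℝ (Y.V →L[ℂ] Y.V) r := by
  have := hY.1
  have hcfc : ∀ f : ℝ → ℝ, cfc f A ∈ intertwiners Y Y := fun f g v => by
    have hc : Commute A (Y.ρ g).toContinuousLinearEquiv.toContinuousLinearMap :=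
      ContinuousLinearMap.ext fun v => hA g v
    exact DFunLike.congr_fun (hc.cfc_real f).eq v
  have hzero : ∀ f : ℝ → ℝ, Continuous f → cfc f A = 0 → ∀ x ∈ spectrum ℝ A, f x = 0 := by
    intro f hf h x hx
    have h1 : f x ∈ spectrum ℝ (cfc f A) := by
      rw [cfc_map_spectrum f A hs hf.continuousOn]
      exact ⟨x, hx, rfl⟩
    rwa [h, spectrum.zero_eq, Set.mem_singleton_iff] at h1
  have hle : ∀ x ∈ spectrum ℝ A, ∀ y ∈ spectrum ℝ A, y ≤ x := by
    intro x hx y hy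
    by_contra! hxy
    obtain ⟨m, hxm, hmy⟩ := exists_between hxy
    have hfc : Continuous fun t : ℝ => max (t - m) 0 := by fun_prop
    have hgc : Continuous fun t : ℝ => max (m - t) 0 := by fun_prop
    have hmul : cfc (fun t : ℝ => max (t - m) 0) A * cfc (fun t : ℝ => max (m - t) 0) A = 0 := by
      rw [← cfc_mul _ _ A hfc.continuousOn hgc.continuousOn]
      have : (fun t : ℝ => max (t - m) 0 * max (m - t) 0) = fun _ => 0 := by
        ext t
        rcases le_total t m with h | h
        · rw [max_eq_right (sub_nonpos.2 h), zero_mul]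
        · rw [max_eq_right (sub_nonpos.2 h), mul_zero]
      rw [this, cfc_const_zero]
    have hker := IsClosedInvariant.ker (hcfc fun t : ℝ => max (t - m) 0)
    rcases hY.2 _ hker.isClosed hker.map_mem with h | h
    · have h0 : cfc (fun t : ℝ => max (m - t) 0) A = 0 := by
        ext v
        have : cfc (fun t : ℝ => max (m - t) 0) A v ∈
            (cfc (fun t : ℝ => max (t - m) 0) A).ker := DFunLike.congr_fun hmul v
        rw [h] at this
        exact this
      have := hzero _ hgc h0 x hx
      rw [max_eq_left (by linarith)] at this
      linarith
    · have h0 : cfc (fun t : ℝ => max (t - m) 0) A = 0 := by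
        ext v
        have : v ∈ (cfc (fun t : ℝ => max (t - m) 0) A).ker := by rw [h]; trivial
        exact this
      have := hzero _ hfc h0 y hy
      rw [max_eq_left (by linarith)] at this
      linarith
  have hsub : ∃ r, spectrum ℝ A ⊆ {r} := by
    rcases (spectrum ℝ A).eq_empty_or_nonempty with h | ⟨r, hr⟩
    · exact ⟨0, by simp [h]⟩
    · exact ⟨r, fun x hx => le_antisymm (hle r hr x hx) (hle x hx r hr)⟩
  obtain ⟨r, hr⟩ := hsub
  exact ⟨r, CFC.eq_algebraMap_of_spectrum_subset_singleton A r hr hs⟩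

/-- **Schur's lemma** for endomorphisms of an irreducible unitary representation. -/
theorem IsIrreducible.exists_eq_smul_id (hY : Y.IsIrreducible) {A : Y.V →L[ℂ] Y.V}
    (hA : A ∈ intertwiners Y Y) : ∃ c : ℂ, A = c • ContinuousLinearMap.id ℂ Y.V := by
  have hstar : star A ∈ intertwiners Y Y := adjoint_mem_intertwiners hA
  have key : ∀ B ∈ intertwiners Y Y, IsSelfAdjoint B →
      ∃ c : ℂ, B = c • ContinuousLinearMap.id ℂ Y.V := fun B hB hs => by
    obtain ⟨r, rfl⟩ := hY.eq_algebraMap_of_isSelfAdjoint hB hs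
    refine ⟨r, ContinuousLinearMap.ext fun v => ?_⟩
    rw [Algebra.algebraMap_eq_smul_one]
    simp
  obtain ⟨a, ha⟩ := key (A + star A) (add_mem hA hstar) (IsSelfAdjoint.add_star_self A)
  obtain ⟨b, hb⟩ := key (Complex.I • (A - star A))
    (Submodule.smul_mem _ _ (sub_mem hA hstar)) (by
      rw [IsSelfAdjoint, star_smul, star_sub, star_star]
      simp [smul_sub]
      abel)
  refine ⟨2⁻¹ * (a - Complex.I * b), ?_⟩
  rw [← smul_smul, sub_smul, ← smul_smul, ← ha, ← hb, smul_smul, Complex.I_mul_I, neg_one_smul,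
    sub_neg_eq_add, add_add_sub_cancel, ← two_smul ℂ A, smul_smul]
  norm_num

theorem IsIrreducible.unitaryEquiv_and_eq_smul (hX : X.IsIrreducible) (hY : Y.IsIrreducible)
    {T : X.V →L[ℂ] Y.V} (hT : T ∈ intertwiners X Y) (hT0 : T ≠ 0) :
    UnitaryEquiv X Y ∧ ∀ T' ∈ intertwiners X Y, ∃ c : ℂ, T' = c • T := by
  have hTs := adjoint_mem_intertwiners hT
  obtain ⟨b, hb⟩ := hY.exists_eq_smul_id (comp_mem_intertwiners hT hTs)
  have hb' : ∀ w, T (ContinuousLinearMap.adjoint T w) = b • w := fun w => DFunLike.congr_fun hb w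
  obtain ⟨r, hr⟩ := hX.eq_algebraMap_of_isSelfAdjoint (comp_mem_intertwiners hTs hT)
    ((ContinuousLinearMap.isSelfAdjoint_iff_isSymmetric).2 fun v w => by
      change ⟪ContinuousLinearMap.adjoint T (T v), w⟫_ℂ = ⟪v, ContinuousLinearMap.adjoint T (T w)⟫_ℂ
      rw [ContinuousLinearMap.adjoint_inner_left, ContinuousLinearMap.adjoint_inner_right])
  have hr' : ∀ v, ContinuousLinearMap.adjoint T (T v) = (r : ℂ) • v := fun v => by
    have := DFunLike.congr_fun hr v
    rw [Algebra.algebraMap_eq_smul_one] at this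
    simpa using this
  have hnorm : ∀ v, ‖T v‖ ^ 2 = r * ‖v‖ ^ 2 := fun v => by
    have h1 : ⟪T v, T v⟫_ℂ = r * ⟪v, v⟫_ℂ := by
      rw [← ContinuousLinearMap.adjoint_inner_right, hr', inner_smul_right]
    rw [InnerProductSpace.norm_sq_eq_re_inner (𝕜 := ℂ), h1,
      InnerProductSpace.norm_sq_eq_re_inner (𝕜 := ℂ) v]
    exact Complex.re_ofReal_mul _ _
  obtain ⟨v₀, hv₀⟩ : ∃ v, T v ≠ 0 := by
    by_contra! h
    exact hT0 (ContinuousLinearMap.ext h)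
  have hrpos : 0 < r := by
    have h1 : 0 < ‖T v₀‖ ^ 2 := by positivity
    rw [hnorm v₀] at h1
    exact pos_of_mul_pos_left h1 (by positivity)
  have hrb : (r : ℂ) = b := by
    have h1 : (r : ℂ) • T v₀ = b • T v₀ := by rw [← hb', hr', map_smul]
    exact smul_left_injective ℂ hv₀ h1
  have hr0 : (r : ℂ) ≠ 0 := by exact_mod_cast hrpos.ne'
  have hsq : 0 < Real.sqrt r := Real.sqrt_pos.2 hrpos
  have hsq0 : ((Real.sqrt r : ℝ) : ℂ) ≠ 0 := by exact_mod_cast hsq.ne'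
  constructor
  · let U : X.V →ₗᵢ[ℂ] Y.V :=
      { toLinearMap := (((Real.sqrt r)⁻¹ : ℝ) : ℂ) • (T : X.V →ₗ[ℂ] Y.V)
        norm_map' := fun v => by
          change ‖(((Real.sqrt r)⁻¹ : ℝ) : ℂ) • T v‖ = ‖v‖
          have h1 : ‖T v‖ = Real.sqrt r * ‖v‖ := by
            rw [← Real.sqrt_sq (norm_nonneg (T v)), hnorm, Real.sqrt_mul hrpos.le,
              Real.sqrt_sq (norm_nonneg v)]
          rw [norm_smul, Complex.norm_real, norm_inv, Real.norm_of_nonneg hsq.le, h1,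
            inv_mul_cancel_left₀ hsq.ne'] }
    have hU : ∀ v, U v = (((Real.sqrt r)⁻¹ : ℝ) : ℂ) • T v := fun _ => rfl
    refine ⟨LinearIsometryEquiv.ofSurjective U fun w =>
      ⟨(Real.sqrt r * (r : ℂ)⁻¹) • ContinuousLinearMap.adjoint T w, ?_⟩, fun g v => ?_⟩
    · rw [hU, map_smul, hb', ← hrb, smul_smul, smul_smul, Complex.ofReal_inv,
        inv_mul_cancel_left₀ hsq0, inv_mul_cancel₀ hr0, one_smul]
    · change U (X.ρ g v) = Y.ρ g (U v)
      rw [hU, hU, hT g v, map_smul]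
  · intro T' hT'
    obtain ⟨c, hc⟩ := hX.exists_eq_smul_id (comp_mem_intertwiners hTs hT')
    refine ⟨(r : ℂ)⁻¹ * c, ContinuousLinearMap.ext fun v => ?_⟩
    have h1 : ContinuousLinearMap.adjoint T (T' v) = c • v := DFunLike.congr_fun hc v
    have h2 : (r : ℂ) • T' v = c • T v := by rw [hrb, ← hb', h1, map_smul]
    rw [smul_apply, ← smul_smul, ← h2, inv_smul_smul₀ hr0]

open Classical in
theorem IsIrreducible.rank_intertwiners_le (hX : X.IsIrreducible) (hY : Y.IsIrreducible) :
    Module.rank ℂ (intertwiners X Y) ≤ ((if UnitaryEquiv X Y then 1 else 0 : ℕ) : Cardinal) := by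
  by_cases h : intertwiners X Y = ⊥
  · rw [h, rank_bot]
    exact zero_le
  · obtain ⟨T, hT, hT0⟩ := Submodule.exists_mem_ne_zero_of_ne_bot h
    obtain ⟨h1, h2⟩ := hX.unitaryEquiv_and_eq_smul hY hT hT0
    rw [if_pos h1, Nat.cast_one, rank_submodule_le_one_iff']
    exact ⟨T, fun T' hT' => by
      obtain ⟨c, rfl⟩ := h2 T' hT'
      exact Submodule.smul_mem _ _ (Submodule.mem_span_singleton_self T)⟩

end Schur

end URep

namespace URep

theorem exists_sign_sum_norm_sq_le {E ι : Type*} [NormedAddCommGroup E] [InnerProductSpace ℝ E]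
    (s : Finset ι) (x : ι → E) : ∃ ε : ι → ℝ, (∀ i, ε i = 1 ∨ ε i = -1) ∧
      ∑ i ∈ s, ‖x i‖ ^ 2 ≤ ‖∑ i ∈ s, ε i • x i‖ ^ 2 := by
  classical
  induction s using Finset.induction_on with
  | empty => exact ⟨fun _ => 1, fun _ => Or.inl rfl, by simp⟩
  | insert a s ha ih =>
    obtain ⟨ε, hε, hle⟩ := ih
    have key : ∀ c : ℝ, (c = 1 ∨ c = -1) →
        ‖x a‖ ^ 2 + ‖∑ i ∈ s, ε i • x i‖ ^ 2 ≤ ‖c • x a + ∑ i ∈ s, ε i • x i‖ ^ 2 →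
        ∃ ε : ι → ℝ, (∀ i, ε i = 1 ∨ ε i = -1) ∧
          ∑ i ∈ insert a s, ‖x i‖ ^ 2 ≤ ‖∑ i ∈ insert a s, ε i • x i‖ ^ 2 := by
      intro c hc h
      refine ⟨Function.update ε a c, fun i => ?_, ?_⟩
      · rcases eq_or_ne i a with rfl | hi
        · simpa using hc
        · simpa [hi] using hε i
      · rw [Finset.sum_insert ha, Finset.sum_insert ha, Function.update_self]
        have : ∑ i ∈ s, Function.update ε a c i • x i = ∑ i ∈ s, ε i • x i :=
          Finset.sum_congr rfl fun i hi => by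
            rw [Function.update_of_ne (ne_of_mem_of_not_mem hi ha)]
        rw [this]
        linarith
    have hpar := parallelogram_law_with_norm ℝ (x a) (∑ i ∈ s, ε i • x i)
    by_cases h : ‖x a‖ ^ 2 + ‖∑ i ∈ s, ε i • x i‖ ^ 2 ≤ ‖(1 : ℝ) • x a + ∑ i ∈ s, ε i • x i‖ ^ 2
    · exact key 1 (Or.inl rfl) h
    · refine key (-1) (Or.inr rfl) ?_
      have h1 : ‖(-1 : ℝ) • x a + ∑ i ∈ s, ε i • x i‖ = ‖x a - ∑ i ∈ s, ε i • x i‖ := by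
        rw [neg_one_smul, neg_add_eq_sub, norm_sub_rev]
      rw [h1]
      rw [one_smul] at h
      nlinarith

theorem _root_.Cardinal.sum_natCast_fintype {ι : Type u} [Fintype ι] (k : ι → ℕ) :
    Cardinal.sum (fun i => (k i : Cardinal.{u})) = ((∑ i, k i : ℕ) : Cardinal.{u}) := by
  have h := Cardinal.mk_sigma fun i : ι => ULift.{u} (Fin (k i))
  rw [Cardinal.mk_fintype] at h
  simpa using h.symm

section Decomposition

variable {G : Type u} [Group G] [TopologicalSpace G]

/-- A finite set of nonzero, pairwise orthogonal, closed invariant subspaces. -/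
structure IsOrthogonalSystem (Y : URep G) (S : Finset (Submodule ℂ Y.V)) : Prop where
  invariant : ∀ F ∈ S, IsClosedInvariant Y F
  ne_bot : ∀ F ∈ S, F ≠ ⊥
  pairwise : ∀ E ∈ S, ∀ F ∈ S, E ≠ F → E ⟂ F

namespace IsOrthogonalSystem

variable {Y : URep G} {S : Finset (Submodule ℂ Y.V)}

theorem orthogonalFamily (hS : IsOrthogonalSystem Y S) :
    OrthogonalFamily ℂ (fun F : S => (F : Submodule ℂ Y.V))
      fun F : S => (F : Submodule ℂ Y.V).subtypeₗᵢ :=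
  fun E F hEF v w => (hS.pairwise E E.2 F F.2 fun h => hEF (Subtype.ext h)).inner_eq v.2 w.2

theorem insert [DecidableEq (Submodule ℂ Y.V)] (hS : IsOrthogonalSystem Y S)
    {E : Submodule ℂ Y.V} (hE : IsClosedInvariant Y E)
    (hE0 : E ≠ ⊥) (horth : ∀ F ∈ S, E ⟂ F) :
    IsOrthogonalSystem Y (insert E S) ∧ (insert E S).card = S.card + 1 := by
  refine ⟨⟨?_, ?_, ?_⟩, Finset.card_insert_of_notMem fun h =>
    hE0 (Submodule.isOrtho_self.1 (horth E h))⟩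
  · simpa [hE] using hS.invariant
  · simpa [hE0] using hS.ne_bot
  · intro A hA B hB hAB
    rcases Finset.mem_insert.1 hA with h | hA
    · rcases Finset.mem_insert.1 hB with h' | hB
      · exact absurd (h.trans h'.symm) hAB
      · exact h ▸ horth B hB
    · rcases Finset.mem_insert.1 hB with h | hB
      · exact h ▸ (horth A hA).symm
      · exact hS.pairwise A hA B hB hAB

theorem subset {S' : Finset (Submodule ℂ Y.V)} (hS : IsOrthogonalSystem Y S) (h : S' ⊆ S) :
    IsOrthogonalSystem Y S' :=
  ⟨fun F hF => hS.invariant F (h hF), fun F hF => hS.ne_bot F (h hF),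
    fun E hE F hF => hS.pairwise E (h hE) F (h hF)⟩

/-- A representation whose algebra of intertwiners is isomorphic, as a real Banach space, to a
Hilbert space has orthogonal systems of bounded size only. -/
theorem exists_card_le (Y : URep G) {E : Type*} [NormedAddCommGroup E]
    [InnerProductSpace ℂ E] (e : E ≃L[ℝ] intertwiners Y Y) :
    ∃ N : ℕ, ∀ S : Finset (Submodule ℂ Y.V), IsOrthogonalSystem Y S → S.card ≤ N := by
  set A := ‖(e : E →L[ℝ] intertwiners Y Y)‖
  set B := ‖(e.symm : intertwiners Y Y →L[ℝ] E)‖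
  obtain ⟨N, hN⟩ := exists_nat_ge (A ^ 2 * B ^ 2)
  refine ⟨N, fun S hS => ?_⟩
  have hc : ∀ F : S, CompleteSpace (F : Submodule ℂ Y.V) := fun F =>
    (hS.invariant F F.2).completeSpace
  let P : S → intertwiners Y Y := fun F =>
    ⟨(F : Submodule ℂ Y.V).starProjection, (hS.invariant F F.2).starProjection_mem⟩
  have hP : ∀ F, ‖P F‖ = 1 := fun F => Submodule.norm_starProjection _ (hS.ne_bot F F.2)
  let _ := InnerProductSpace.complexToReal (G := E)
  obtain ⟨ε, hε, hle⟩ := exists_sign_sum_norm_sq_le Finset.univ fun F => e.symm (P F)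
  have hsum : ‖∑ F, ε F • P F‖ ≤ 1 := by
    refine ContinuousLinearMap.opNorm_le_bound _ zero_le_one fun v => ?_
    rw [one_mul]
    have hv : ((∑ F, ε F • P F : intertwiners Y Y) : Y.V →L[ℂ] Y.V) v =
        ∑ F : S, ε F • (F : Submodule ℂ Y.V).starProjection v := by
      simp only [Submodule.coe_sum, sum_apply, P]
      rfl
    have hnorm : ∀ δ : S → ℝ, (∀ F, δ F = 1 ∨ δ F = -1) →
        ‖∑ F : S, δ F • (F : Submodule ℂ Y.V).starProjection v‖ ^ 2 =
          ∑ F : S, ‖(F : Submodule ℂ Y.V).starProjection v‖ ^ 2 := by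
      intro δ hδ
      have := hS.orthogonalFamily.norm_sum
        (fun F => ((δ F : ℂ) • (F : Submodule ℂ Y.V).orthogonalProjectionOnto v)) Finset.univ
      refine Eq.trans (Eq.trans ?_ this) ?_
      · rfl
      · refine Finset.sum_congr rfl fun F _ => ?_
        rw [norm_smul]
        have : ‖(δ F : ℂ)‖ = 1 := by rcases hδ F with h | h <;> simp [h]
        rw [this, one_mul]
        rfl
    set b := ∑ F : S, ‖(F : Submodule ℂ Y.V).starProjection v‖ ^ 2 with hb
    have hone := hnorm (fun _ => 1) fun _ => Or.inl rfl
    simp only [one_smul] at hone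
    have hinner : ⟪∑ F : S, (F : Submodule ℂ Y.V).starProjection v, v⟫_ℂ = (b : ℂ) := by
      rw [sum_inner, hb, Complex.ofReal_sum]
      refine Finset.sum_congr rfl fun F _ => ?_
      have h1 : ⟪(F : Submodule ℂ Y.V).starProjection v, v⟫_ℂ =
          ⟪(F : Submodule ℂ Y.V).starProjection v, (F : Submodule ℂ Y.V).starProjection v⟫_ℂ := by
        rw [Submodule.inner_starProjection_left_eq_right,
          Submodule.inner_starProjection_left_eq_right, ← ContinuousLinearMap.comp_apply, ← ContinuousLinearMap.mul_def,
          (Submodule.isIdempotentElem_starProjection _).eq]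
      rw [h1, inner_self_eq_norm_sq_to_K]
      simp
    have hb0 : 0 ≤ b := Finset.sum_nonneg fun _ _ => by positivity
    have hcs := norm_inner_le_norm (𝕜 := ℂ) (∑ F : S, (F : Submodule ℂ Y.V).starProjection v) v
    rw [hinner, Complex.norm_real, Real.norm_of_nonneg hb0] at hcs
    change ‖((∑ F, ε F • P F : intertwiners Y Y) : Y.V →L[ℂ] Y.V) v‖ ≤ ‖v‖
    rw [hv]
    refine le_of_sq_le_sq ?_ (norm_nonneg v)
    rw [hnorm ε hε]
    rcases hb0.eq_or_lt with h0 | h0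
    · rw [← h0]; positivity
    · have h2 : b ^ 2 ≤ b * ‖v‖ ^ 2 := by
        rw [← hone, ← mul_pow, hone]
        exact pow_le_pow_left₀ hb0 hcs 2
      nlinarith
  have hterm : ∀ F : S, 1 ≤ A ^ 2 * ‖e.symm (P F)‖ ^ 2 := fun F => by
    have h1 := (e : E →L[ℝ] intertwiners Y Y).le_opNorm (e.symm (P F))
    have h2 : (e : E →L[ℝ] intertwiners Y Y) (e.symm (P F)) = P F := e.apply_symm_apply _
    rw [h2, hP] at h1
    rw [← mul_pow]
    exact one_le_pow₀ h1
  have hupper : ‖∑ F, ε F • e.symm (P F)‖ ≤ B := by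
    have h1 : ∑ F, ε F • e.symm (P F) = e.symm (∑ F, ε F • P F) := by
      rw [map_sum]
      exact Finset.sum_congr rfl fun F _ => (map_smul _ _ _).symm
    rw [h1]
    exact (e.symm : intertwiners Y Y →L[ℝ] E).le_of_opNorm_le_of_le le_rfl hsum |>.trans_eq
      (mul_one _)
  have hcard : (S.card : ℝ) ≤ A ^ 2 * B ^ 2 := by
    calc (S.card : ℝ) = ∑ _F : S, (1 : ℝ) := by simp
      _ ≤ ∑ F : S, A ^ 2 * ‖e.symm (P F)‖ ^ 2 := Finset.sum_le_sum fun F _ => hterm F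
      _ = A ^ 2 * ∑ F : S, ‖e.symm (P F)‖ ^ 2 := by rw [Finset.mul_sum]
      _ ≤ A ^ 2 * B ^ 2 := by
        gcongr
        exact hle.trans (pow_le_pow_left₀ (norm_nonneg _) hupper 2)
  exact_mod_cast hcard.trans hN

end IsOrthogonalSystem

/-- If orthogonal systems have bounded size, there is one that consists of irreducible
subrepresentations and has dense span. -/
theorem exists_irreducible_orthogonalSystem (Y : URep G) (N : ℕ)
    (hN : ∀ S : Finset (Submodule ℂ Y.V), IsOrthogonalSystem Y S → S.card ≤ N) :
    ∃ S, ∃ hS : IsOrthogonalSystem Y S,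
      (∀ F (hF : F ∈ S), (hS.invariant F hF).subrep.IsIrreducible) ∧
      (⨆ F : S, (F : Submodule ℂ Y.V))ᗮ = ⊥ := by
  classical
  have hne : ∃ k ≤ N, ∃ S, IsOrthogonalSystem Y S ∧ S.card = k :=
    ⟨0, N.zero_le, ∅, ⟨by simp, by simp, by simp⟩, rfl⟩
  obtain ⟨S, hS, hcard⟩ : ∃ S, IsOrthogonalSystem Y S ∧
      S.card = Nat.findGreatest (fun k => ∃ S, IsOrthogonalSystem Y S ∧ S.card = k) N := by
    obtain ⟨k, hk, h⟩ := hne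
    exact Nat.findGreatest_spec (P := fun k => ∃ S, IsOrthogonalSystem Y S ∧ S.card = k) hk h
  have hmax : ∀ S', IsOrthogonalSystem Y S' → S'.card ≤ S.card := fun S' hS' => by
    rw [hcard]
    exact Nat.le_findGreatest (hN S' hS') ⟨S', hS', rfl⟩
  refine ⟨S, hS, fun F hF => ?_, ?_⟩
  · refine (hS.invariant F hF).isIrreducible_subrep (hS.ne_bot F hF) fun E hE hEF => ?_
    by_contra! h
    have hE' := hE.orthogonal.inf (hS.invariant F hF)
    have hne : Eᗮ ⊓ F ≠ ⊥ := fun h0 => by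
      have := hE.completeSpace
      have := Submodule.sup_orthogonal_inf_of_hasOrthogonalProjection hEF
      rw [h0, sup_bot_eq] at this
      exact h.2 this
    have h1 := (hS.subset (S.erase_subset F)).insert hE h.1 fun A hA =>
      (hS.pairwise F hF A (Finset.mem_of_mem_erase hA)
        (Finset.ne_of_mem_erase hA).symm).mono_left hEF
    have h2 := h1.1.insert hE' hne fun A hA => by
      rcases Finset.mem_insert.1 hA with rfl | hA
      · exact (Submodule.isOrtho_orthogonal_left _).mono_left inf_le_left
      · exact (hS.pairwise F hF A (Finset.mem_of_mem_erase hA)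
          (Finset.ne_of_mem_erase hA).symm).mono_left inf_le_right
    have h3 := hmax _ h2.1
    rw [h2.2, h1.2, Finset.card_erase_add_one hF] at h3
    omega
  · by_contra h
    have hinv : IsClosedInvariant Y (⨆ F : S, (F : Submodule ℂ Y.V))ᗮ := by
      rw [← Submodule.iInf_orthogonal]
      refine ⟨?_, fun g v hv => ?_⟩
      · rw [Submodule.coe_iInf]
        exact isClosed_iInter fun F => Submodule.isClosed_orthogonal _
      · rw [Submodule.mem_iInf] at hv ⊢
        exact fun F => (hS.invariant F F.2).orthogonal.map_mem g v (hv F)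
    have h1 := hS.insert hinv h fun F hF =>
      (Submodule.isOrtho_orthogonal_left _).mono_right
        (le_iSup (fun F : S => (F : Submodule ℂ Y.V)) ⟨F, hF⟩)
    have h2 := hmax _ h1.1
    rw [h1.2] at h2
    omega

/-- Orthogonal isometric embeddings with dense span exhibit a representation as a direct sum. -/
theorem unitaryEquiv_directSum {Y : URep G} {n : ℕ} {Z : Fin n → URep G}
    (J : ∀ i, (Z i).V →ₗᵢ[ℂ] Y.V) (hJ : ∀ i g v, J i ((Z i).ρ g v) = Y.ρ g (J i v))
    (hfam : OrthogonalFamily ℂ (fun i => (Z i).V) J)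
    (hdense : (⨆ i, LinearMap.range (J i).toLinearMap)ᗮ = ⊥) :
    UnitaryEquiv Y (directSum Z) := by
  let A : PiLp 2 (fun i => (Z i).V) →ₗᵢ[ℂ] Y.V :=
    { toFun := fun v => ∑ i, J i (v i)
      map_add' := fun v w => by simp [Finset.sum_add_distrib]
      map_smul' := fun c v => by simp [Finset.smul_sum]
      norm_map' := fun v => by
        have h1 : ‖∑ i, J i (v i)‖ ^ 2 = ∑ i, ‖v i‖ ^ 2 :=
          hfam.norm_sum (fun i => v i) Finset.univ
        have h2 : ‖v‖ ^ 2 = ∑ i, ‖v i‖ ^ 2 := PiLp.norm_sq_eq_of_L2 _ v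
        exact (sq_eq_sq₀ (norm_nonneg _) (norm_nonneg _)).1 (h1.trans h2.symm) }
  have hA : ∀ v, A v = ∑ i, J i (v i) := fun _ => rfl
  have hrange : ∀ i, LinearMap.range (J i).toLinearMap ≤ LinearMap.range A.toLinearMap := by
    rintro i _ ⟨x, rfl⟩
    refine ⟨WithLp.toLp 2 (Pi.single i x), ?_⟩
    change A _ = J i x
    rw [hA, Finset.sum_eq_single i]
    · simp
    · intro k _ hk
      simp [hk]
    · exact fun h => absurd (Finset.mem_univ i) h
  have hsurj : Function.Surjective A := by
    have hcl : IsClosed (LinearMap.range A.toLinearMap : Set Y.V) :=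
      A.isometry.isClosedEmbedding.isClosed_range
    have hcomp : CompleteSpace (LinearMap.range A.toLinearMap) := hcl.completeSpace_coe
    have h1 : LinearMap.range A.toLinearMap = ⊤ := by
      rw [← Submodule.orthogonal_eq_bot_iff, eq_bot_iff, ← hdense]
      exact Submodule.orthogonal_le (iSup_le hrange)
    exact LinearMap.range_eq_top.1 h1
  refine UnitaryEquiv.symm ⟨LinearIsometryEquiv.ofSurjective A hsurj, fun g v => ?_⟩
  change ∑ i, J i ((Z i).ρ g ((show PiLp 2 (fun i => (Z i).V) from v) i)) =
    Y.ρ g (∑ i, J i ((show PiLp 2 (fun i => (Z i).V) from v) i))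
  rw [map_sum]
  exact Finset.sum_congr rfl fun i _ => hJ i g _

/-- If orthogonal systems have bounded size, the representation is a finite direct sum of
irreducible representations. -/
theorem exists_unitaryEquiv_directSum (Y : URep G) (N : ℕ)
    (hN : ∀ S : Finset (Submodule ℂ Y.V), IsOrthogonalSystem Y S → S.card ≤ N) :
    ∃ (n : ℕ) (Z : Fin n → URep G), (∀ i, (Z i).IsIrreducible) ∧ UnitaryEquiv Y (directSum Z) := by
  obtain ⟨S, hS, hirr, hdense⟩ := exists_irreducible_orthogonalSystem Y N hN
  let j : Fin S.card ≃ S := S.equivFin.symm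
  refine ⟨S.card, fun i => (hS.invariant (j i) (j i).2).subrep, fun i => hirr _ (j i).2,
    unitaryEquiv_directSum (fun i => (j i : Submodule ℂ Y.V).subtypeₗᵢ) (fun _ _ _ => rfl)
      (hS.orthogonalFamily.comp j.injective) ?_⟩
  rw [eq_bot_iff, ← hdense]
  refine Submodule.orthogonal_le (iSup_le fun F x hx => ?_)
  refine Submodule.mem_iSup_of_mem (j.symm F) ⟨⟨x, ?_⟩, rfl⟩
  rwa [Equiv.apply_symm_apply]

open Classical in
/-- If `X` has an orthogonal system of irreducible subspaces with dense span, the rank of the space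
of intertwiners into an irreducible `Y` is at most the number of constituents equivalent to `Y`. -/
theorem rank_intertwiners_le_card {X Y : URep G} (hY : Y.IsIrreducible)
    {S : Finset (Submodule ℂ X.V)} (hS : IsOrthogonalSystem X S)
    (hirr : ∀ F (hF : F ∈ S), (hS.invariant F hF).subrep.IsIrreducible)
    (hdense : (⨆ F : S, (F : Submodule ℂ X.V))ᗮ = ⊥) :
    Module.rank ℂ (intertwiners X Y) ≤
      ((∑ F : S, if UnitaryEquiv (hS.invariant F F.2).subrep Y then 1 else 0 : ℕ) : Cardinal) := by
  let R : intertwiners X Y →ₗ[ℂ] (F : S) → intertwiners (hS.invariant F F.2).subrep Y :=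
    LinearMap.pi fun F =>
      { toFun := fun T => ⟨T.1 ∘L (F : Submodule ℂ X.V).subtypeL,
          comp_mem_intertwiners T.2 (hS.invariant F F.2).subtypeL_mem⟩
        map_add' := fun _ _ => rfl
        map_smul' := fun _ _ => rfl }
  have hR : Function.Injective R := by
    refine (injective_iff_map_eq_zero R).2 fun T hT => ?_
    have h1 : (⨆ F : S, (F : Submodule ℂ X.V)) ≤ T.1.ker := iSup_le fun F x hx =>
      DFunLike.congr_fun (congrArg Subtype.val (congrFun hT F)) (⟨x, hx⟩ : (F : Submodule ℂ X.V))
    have hcomp : CompleteSpace T.1.ker := T.1.isClosed_ker.completeSpace_coe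
    have h2 : T.1.ker = ⊤ := by
      rw [← Submodule.orthogonal_eq_bot_iff, eq_bot_iff, ← hdense]
      exact Submodule.orthogonal_le h1
    refine Subtype.ext (ContinuousLinearMap.ext fun v => ?_)
    have : v ∈ T.1.ker := by rw [h2]; trivial
    exact this
  refine (LinearMap.rank_le_of_injective R hR).trans ?_
  rw [rank_pi]
  refine (Cardinal.sum_le_sum _ _ fun F : S => (hirr F F.2).rank_intertwiners_le hY).trans_eq ?_
  exact Cardinal.sum_natCast_fintype _

end Decomposition

end URep

namespace URep

section Trivial

variable {K : Type u} [Group K] [TopologicalSpace K]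

/-- The one-dimensional trivial representation. -/
def trivial (K : Type u) [Group K] [TopologicalSpace K] : URep K where
  V := EuclideanSpace ℂ PUnit.{u + 1}
  ρ := 1
  continuous_ρ := fun _ => continuous_const

/-- The unit vector of the trivial representation. -/
def trivialOne (K : Type u) [Group K] [TopologicalSpace K] : (trivial K).V :=
  (EuclideanSpace.single PUnit.unit 1 : EuclideanSpace ℂ PUnit.{u + 1})

/-- The coordinate on the trivial representation. -/
def trivialCoord (K : Type u) [Group K] [TopologicalSpace K] : (trivial K).V →L[ℂ] ℂ :=
  (EuclideanSpace.proj PUnit.unit : EuclideanSpace ℂ PUnit.{u + 1} →L[ℂ] ℂ)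

@[simp] theorem trivialCoord_one : trivialCoord K (trivialOne K) = 1 := by
  change (EuclideanSpace.single PUnit.unit (1 : ℂ) : EuclideanSpace ℂ PUnit.{u + 1}) PUnit.unit = 1
  simp

theorem trivialCoord_smul_one (v : (trivial K).V) : trivialCoord K v • trivialOne K = v := by
  change EuclideanSpace ℂ PUnit.{u + 1} at v
  refine PiLp.ext fun i => ?_
  change v PUnit.unit * (EuclideanSpace.single PUnit.unit (1 : ℂ) : EuclideanSpace ℂ PUnit) i = v i
  cases i
  simp

theorem inner_trivial (v w : (trivial K).V) :
    ⟪v, w⟫_ℂ = ⟪trivialCoord K v, trivialCoord K w⟫_ℂ := by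
  change EuclideanSpace ℂ PUnit.{u + 1} at v w
  change ⟪v, w⟫_ℂ = ⟪v PUnit.unit, w PUnit.unit⟫_ℂ
  simp [PiLp.inner_apply]

theorem norm_trivialCoord (v : (trivial K).V) : ‖trivialCoord K v‖ = ‖v‖ := by
  rw [← sq_eq_sq₀ (norm_nonneg _) (norm_nonneg _), InnerProductSpace.norm_sq_eq_re_inner (𝕜 := ℂ),
    InnerProductSpace.norm_sq_eq_re_inner (𝕜 := ℂ) v, inner_trivial]

@[simp] theorem trivial_ρ (k : K) (v : (trivial K).V) : (trivial K).ρ k v = v := rfl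

/-- The invariant vectors of a representation. -/
def invariants (X : URep K) : Submodule ℂ X.V := fixedVectors ⊤ X

theorem mem_invariants {X : URep K} {v : X.V} : v ∈ invariants X ↔ ∀ k, X.ρ k v = v :=
  ⟨fun h k => h k _root_.trivial, fun h k _ => h k⟩

instance (X : URep K) : CompleteSpace (invariants X) :=
  (isClosed_fixedVectors ⊤ X).completeSpace_coe

/-- The morphism from the trivial representation given by an invariant vector. -/
def ofInvariant (X : URep K) : invariants X →ₗ[ℝ] ((trivial K).V →L[ℂ] X.V) where
  toFun v := (trivialCoord K).smulRight v.1
  map_add' v w := by ext x; simp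
  map_smul' c v := by
    ext x
    simp only [ContinuousLinearMap.smulRight_apply, RingHom.id_apply]
    exact smul_comm _ _ _

theorem ofInvariant_apply (X : URep K) (v : invariants X) (x : (trivial K).V) :
    ofInvariant X v x = trivialCoord K x • (v : X.V) := rfl

theorem ofInvariant_mem {X : URep K} (v : invariants X) :
    ofInvariant X v ∈ intertwiners (trivial K) X := fun k x => by
  rw [ofInvariant_apply, ofInvariant_apply, map_smul, mem_invariants.1 v.2, trivial_ρ]

theorem norm_ofInvariant_le {X : URep K} (v : invariants X) : ‖ofInvariant X v‖ ≤ ‖v‖ :=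
  ContinuousLinearMap.opNorm_le_bound _ (norm_nonneg _) fun x => by
    rw [ofInvariant_apply, norm_smul, norm_trivialCoord, mul_comm]
    rfl

theorem ofInvariant_injective (X : URep K) : Function.Injective (ofInvariant X) :=
  fun v w h => Subtype.ext <| by
    have := DFunLike.congr_fun h (trivialOne K)
    simpa [ofInvariant_apply] using this

theorem apply_trivialOne_mem {X : URep K} {T : (trivial K).V →L[ℂ] X.V}
    (hT : T ∈ intertwiners (trivial K) X) : T (trivialOne K) ∈ invariants X :=
  mem_invariants.2 fun k => (hT k _).symm

theorem exists_ofInvariant_eq {X : URep K} {T : (trivial K).V →L[ℂ] X.V}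
    (hT : T ∈ intertwiners (trivial K) X) : ∃ v, ofInvariant X v = T :=
  ⟨⟨_, apply_trivialOne_mem hT⟩, ContinuousLinearMap.ext fun x => by
    rw [ofInvariant_apply, ← map_smul, trivialCoord_smul_one]⟩

/-- The morphism to the trivial representation given by the inner product with an invariant
vector. -/
def toTrivial (X : URep K) : invariants X →ₗ[ℝ] (X.V →L[ℂ] (trivial K).V) where
  toFun v := (innerSL ℂ (v : X.V)).smulRight (trivialOne K)
  map_add' v w := by ext x; simp [add_smul]
  map_smul' c v := by
    ext x
    simp only [ContinuousLinearMap.smulRight_apply, RingHom.id_apply]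
    change ⟪(c : ℂ) • (v : X.V), x⟫_ℂ • trivialOne K = (c : ℂ) • ⟪(v : X.V), x⟫_ℂ • trivialOne K
    rw [inner_smul_left, Complex.conj_ofReal, smul_smul]

theorem toTrivial_apply (X : URep K) (v : invariants X) (x : X.V) :
    toTrivial X v x = ⟪(v : X.V), x⟫_ℂ • trivialOne K := rfl

@[simp] theorem trivialCoord_toTrivial (X : URep K) (v : invariants X) (x : X.V) :
    trivialCoord K (toTrivial X v x) = ⟪(v : X.V), x⟫_ℂ := by
  simp [toTrivial_apply]

theorem toTrivial_mem {X : URep K} (v : invariants X) :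
    toTrivial X v ∈ intertwiners X (trivial K) := fun k x => by
  rw [toTrivial_apply, toTrivial_apply, trivial_ρ, ← inv_inv k, ← inner_ρ_left]
  rw [mem_invariants.1 v.2]

theorem norm_toTrivial_le {X : URep K} (v : invariants X) : ‖toTrivial X v‖ ≤ ‖v‖ :=
  ContinuousLinearMap.opNorm_le_bound _ (norm_nonneg _) fun x => by
    rw [← norm_trivialCoord, trivialCoord_toTrivial]
    exact norm_inner_le_norm _ _

theorem toTrivial_injective (X : URep K) : Function.Injective (toTrivial X) :=
  fun v w h => Subtype.ext <| ext_inner_right ℂ fun x => by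
    have := congrArg (trivialCoord K) (DFunLike.congr_fun h x)
    simpa using this

theorem exists_toTrivial_eq {X : URep K} {T : X.V →L[ℂ] (trivial K).V}
    (hT : T ∈ intertwiners X (trivial K)) : ∃ v, toTrivial X v = T := by
  let ξ := ContinuousLinearMap.adjoint T (trivialOne K)
  refine ⟨⟨ξ, apply_trivialOne_mem (adjoint_mem_intertwiners hT)⟩,
    ContinuousLinearMap.ext fun x => ?_⟩
  rw [toTrivial_apply, ContinuousLinearMap.adjoint_inner_left, inner_trivial, trivialCoord_one]
  simp [trivialCoord_smul_one]

end Trivial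

section Restriction

variable {G : Type u} [Group G] [TopologicalSpace G]

theorem mem_invariants_Res {H : Subgroup G} {X : URep G} {v : X.V} :
    v ∈ invariants ((Res H).obj X) ↔ v ∈ fixedVectors H X :=
  mem_invariants.trans ⟨fun h k hk => h ⟨k, hk⟩, fun h k => h k k.2⟩

/-- A representation `W` with an `H`-fixed vector `ξ` representing the functor of `H`-fixed
vectors. -/
def IsUniversalFixedVector (H : Subgroup G) (W : URep G) (ξ : W.V) : Prop :=
  ξ ∈ fixedVectors H W ∧ ∀ (Y : URep G), ∀ v ∈ fixedVectors H Y,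
    ∃! T : W.V →L[ℂ] Y.V, T ∈ intertwiners W Y ∧ T ξ = v

theorem exists_isUniversalFixedVector_of_isRightAdjoint (H : Subgroup G)
    (h : (Res H).IsRightAdjoint) : ∃ W ξ, IsUniversalFixedVector H W ξ := by
  obtain ⟨L, ⟨adj⟩⟩ := h.exists_leftAdjoint
  let e := fun Y : URep G => adj.homEquiv (trivial H) Y
  let η : Hom (trivial H) ((Res H).obj (L.obj (trivial H))) := adj.unit.app (trivial H)
  have he : ∀ (Y : URep G) (T : Hom (L.obj (trivial H)) Y),
      (show Hom _ _ from e Y T).toCLM (trivialOne H) = T.toCLM (η.toCLM (trivialOne H)) := by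
    intro Y T
    have := adj.homEquiv_unit (X := trivial H) (f := (T : L.obj (trivial H) ⟶ Y))
    exact congrArg (fun S : Hom (trivial H) ((Res H).obj Y) => S.toCLM (trivialOne H)) this
  refine ⟨L.obj (trivial H), η.toCLM (trivialOne H),
    mem_invariants_Res.1 (apply_trivialOne_mem η.comm), fun Y v hv => ?_⟩
  let v' : invariants ((Res H).obj Y) := ⟨v, mem_invariants_Res.2 hv⟩
  let T : Hom (L.obj (trivial H)) Y := (e Y).symm
    (⟨ofInvariant _ v', ofInvariant_mem v'⟩ : Hom (trivial H) ((Res H).obj Y))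
  refine ⟨T.toCLM, ⟨T.comm, ?_⟩, ?_⟩
  · rw [← he, Equiv.apply_symm_apply]
    change trivialCoord H (trivialOne H) • v = v
    rw [trivialCoord_one, one_smul]
  · rintro S ⟨hS, hSv⟩
    have : (⟨S, hS⟩ : Hom (L.obj (trivial H)) Y) = T := by
      refine (Equiv.eq_symm_apply _).2 (Hom.ext (ContinuousLinearMap.ext fun x => ?_))
      have h1 := he Y ⟨S, hS⟩
      rw [← trivialCoord_smul_one x, map_smul, map_smul]
      congr 1
      refine h1.trans (hSv.trans ?_)
      change v = trivialCoord H (trivialOne H) • v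
      rw [trivialCoord_one, one_smul]
    exact congrArg Hom.toCLM this

theorem exists_isUniversalFixedVector_of_isLeftAdjoint (H : Subgroup G)
    (h : (Res H).IsLeftAdjoint) : ∃ W ξ, IsUniversalFixedVector H W ξ := by
  obtain ⟨R, ⟨adj⟩⟩ := h.exists_rightAdjoint
  let e := fun Y : URep G => adj.homEquiv Y (trivial H)
  let ε : Hom ((Res H).obj (R.obj (trivial H))) (trivial H) := adj.counit.app (trivial H)
  obtain ⟨ξ, hξ, hξε⟩ : ∃ ξ : (R.obj (trivial H)).V, ξ ∈ fixedVectors H (R.obj (trivial H)) ∧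
      ∀ w : (R.obj (trivial H)).V, trivialCoord H (ε.toCLM w) = ⟪ξ, w⟫_ℂ := by
    obtain ⟨ξ, hξ⟩ := exists_toTrivial_eq (T := ε.toCLM) ε.comm
    refine ⟨ξ.1, mem_invariants_Res.1 ξ.2, fun w => ?_⟩
    rw [← hξ]
    exact trivialCoord_toTrivial _ ξ w
  have he : ∀ (Y : URep G) (T : Hom Y (R.obj (trivial H))) (y : Y.V),
      trivialCoord H ((show Hom _ _ from (e Y).symm T).toCLM y) = ⟪ξ, T.toCLM y⟫_ℂ := by
    intro Y T y
    have := adj.homEquiv_counit (Y := trivial H) (g := (T : Y ⟶ R.obj (trivial H)))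
    exact (congrArg (fun S : Hom ((Res H).obj Y) (trivial H) => trivialCoord H (S.toCLM y))
      this).trans (hξε (T.toCLM y))
  refine ⟨R.obj (trivial H), ξ, hξ, fun Y v hv => ?_⟩
  let v' : invariants ((Res H).obj Y) := ⟨v, mem_invariants_Res.2 hv⟩
  let T : Hom Y (R.obj (trivial H)) := e Y
    (⟨toTrivial _ v', toTrivial_mem v'⟩ : Hom ((Res H).obj Y) (trivial H))
  have hT : ∀ y, ⟪ξ, T.toCLM y⟫_ℂ = ⟪v, y⟫_ℂ := fun y => by
    rw [← he, Equiv.symm_apply_apply]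
    exact trivialCoord_toTrivial ((Res H).obj Y) v' y
  refine ⟨ContinuousLinearMap.adjoint T.toCLM, ⟨adjoint_mem_intertwiners T.comm, ?_⟩, ?_⟩
  · refine ext_inner_right ℂ fun y => ?_
    rw [ContinuousLinearMap.adjoint_inner_left, hT]
  · rintro S ⟨hS, hSv⟩
    have : (⟨ContinuousLinearMap.adjoint S, adjoint_mem_intertwiners hS⟩ :
        Hom Y (R.obj (trivial H))) = T := by
      refine (e Y).symm.injective (Hom.ext (ContinuousLinearMap.ext fun y => ?_))
      rw [← trivialCoord_smul_one (Hom.toCLM _ y)]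
      refine Eq.trans ?_ (trivialCoord_smul_one _)
      congr 1
      refine (he Y _ y).trans (Eq.trans ?_ (he Y T y).symm)
      exact ((ContinuousLinearMap.adjoint_inner_right S ξ y).trans (by rw [hSv])).trans (hT y).symm
    rw [← congrArg Hom.toCLM this, ContinuousLinearMap.adjoint_adjoint]

namespace IsUniversalFixedVector

variable {H : Subgroup G} {W : URep G} {ξ : W.V}

/-- Evaluation of intertwiners at a fixed vector. -/
def evalFixed (hξ : ξ ∈ fixedVectors H W) (Y : URep G) :
    intertwiners W Y →ₗ[ℂ] fixedVectors H Y where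
  toFun T := ⟨T.1 ξ, fun k hk => by rw [← T.2, hξ k hk]⟩
  map_add' _ _ := rfl
  map_smul' _ _ := rfl

/-- Evaluation at a universal fixed vector. -/
def evalEquiv (h : IsUniversalFixedVector H W ξ) (Y : URep G) :
    intertwiners W Y ≃ₗ[ℂ] fixedVectors H Y :=
  LinearEquiv.ofBijective (evalFixed h.1 Y) (by
    refine ⟨fun S T hST => ?_, fun v => ?_⟩
    · obtain ⟨U, -, hU⟩ := h.2 Y (T.1 ξ) (evalFixed h.1 Y T).2
      exact Subtype.ext ((hU S.1 ⟨S.2, congrArg Subtype.val hST⟩).trans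
        (hU T.1 ⟨T.2, rfl⟩).symm)
    · obtain ⟨T, ⟨hT, hTv⟩, -⟩ := h.2 Y v v.2
      exact ⟨⟨T, hT⟩, Subtype.ext hTv⟩)

theorem continuous_evalEquiv (h : IsUniversalFixedVector H W ξ) (Y : URep G) :
    Continuous (h.evalEquiv Y) :=
  Continuous.subtype_mk
    ((ContinuousLinearMap.apply ℂ Y.V ξ).continuous.comp continuous_subtype_val) _

theorem exists_card_le (h : IsUniversalFixedVector H W ξ) :
    ∃ N : ℕ, ∀ S : Finset (Submodule ℂ W.V), IsOrthogonalSystem W S → S.card ≤ N :=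
  let e := ((h.evalEquiv W).toContinuousLinearEquivOfContinuous (h.continuous_evalEquiv W)).symm
  IsOrthogonalSystem.exists_card_le W (E := fixedVectors H W)
    { e.toLinearEquiv.restrictScalars ℝ with
      continuous_toFun := e.continuous
      continuous_invFun := e.symm.continuous }

theorem tsum_fixedDim_lt_top (h : IsUniversalFixedVector H W ξ) :
    ∑' Y : Dual G, (Dual.fixedDim H Y : ℝ≥0∞) < ⊤ := by
  classical
  obtain ⟨N, hN⟩ := h.exists_card_le
  obtain ⟨S, hS, hirr, hdense⟩ := exists_irreducible_orthogonalSystem W N hN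
  let c : S → Dual G := fun F =>
    Quotient.mk (irrepSetoid G) ⟨(hS.invariant F F.2).subrep, hirr F F.2⟩
  have hle : ∀ Y : Dual G, (Dual.fixedDim H Y : ℝ≥0∞) ≤
      ∑ F : S, if Y = c F then 1 else 0 := by
    intro Y
    induction Y using Quotient.inductionOn with
    | h Y =>
      have h1 : fixedDim H Y.1 ≤
          ((∑ F : S, if UnitaryEquiv (hS.invariant F F.2).subrep Y.1 then 1 else 0 : ℕ) : ℕ∞) := by
        rw [fixedDim, Cardinal.toENat_le_natCast, ← (h.evalEquiv Y.1).rank_eq]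
        exact rank_intertwiners_le_card Y.2 hS hirr hdense
      refine (ENat.toENNReal_le.2 h1).trans_eq ?_
      rw [ENat.toENNReal_coe, Nat.cast_sum]
      refine Finset.sum_congr rfl fun F _ => ?_
      have h2 : Quotient.mk (irrepSetoid G) Y = c F ↔
          UnitaryEquiv (hS.invariant F F.2).subrep Y.1 :=
        Quotient.eq.trans ⟨fun h => UnitaryEquiv.symm h, fun h => UnitaryEquiv.symm h⟩
      rw [Nat.cast_ite, Nat.cast_one, Nat.cast_zero]
      exact if_congr h2.symm rfl rfl
  refine (ENNReal.tsum_le_tsum hle).trans_lt ?_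
  rw [Summable.tsum_finsetSum fun _ _ => ENNReal.summable]
  simp only [tsum_ite_eq]
  simp

end IsUniversalFixedVector

end Restriction

end URep

namespace URep

theorem IsOrthogonalSystem.exists_card_le_of_bijective {G : Type u} [Group G] [TopologicalSpace G]
    (Y : URep G) {E : Type*} [NormedAddCommGroup E] [InnerProductSpace ℂ E] [CompleteSpace E]
    (f : E → intertwiners Y Y) (hadd : ∀ v w, f (v + w) = f v + f w)
    (C : ℝ) (hC : ∀ v, ‖f v‖ ≤ C * ‖v‖) (hf : Function.Bijective f) :
    ∃ N : ℕ, ∀ S : Finset (Submodule ℂ Y.V), IsOrthogonalSystem Y S → S.card ≤ N := by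
  let F : E →L[ℝ] intertwiners Y Y := (AddMonoidHom.mk' f hadd).toRealLinearMap
    (AddMonoidHomClass.continuous_of_bound _ C hC)
  exact IsOrthogonalSystem.exists_card_le Y (ContinuousLinearEquiv.ofBijective F
    (LinearMap.ker_eq_bot.2 hf.1) (LinearMap.range_eq_top.2 hf.2))

/-- Invariant vectors are morphisms from the trivial representation. -/
theorem bijective_homOfInvariant {K : Type u} [Group K] [TopologicalSpace K] (X : URep K) :
    Function.Bijective fun v : invariants X =>
      (⟨ofInvariant X v, ofInvariant_mem v⟩ : Hom (trivial K) X) :=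
  ⟨fun _ _ h => ofInvariant_injective X (congrArg Hom.toCLM h), fun T => by
    obtain ⟨v, hv⟩ := exists_ofInvariant_eq T.comm
    exact ⟨v, Hom.ext hv⟩⟩

/-- Invariant vectors are morphisms to the trivial representation. -/
theorem bijective_homToTrivial {K : Type u} [Group K] [TopologicalSpace K] (X : URep K) :
    Function.Bijective fun v : invariants X =>
      (⟨toTrivial X v, toTrivial_mem v⟩ : Hom X (trivial K)) :=
  ⟨fun _ _ h => toTrivial_injective X (congrArg Hom.toCLM h), fun T => by
    obtain ⟨v, hv⟩ := exists_toTrivial_eq T.comm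
    exact ⟨v, Hom.ext hv⟩⟩

theorem bijective_homToIntertwiners {K : Type u} [Group K] [TopologicalSpace K] (X Y : URep K) :
    Function.Bijective fun T : Hom X Y => (⟨T.toCLM, T.comm⟩ : intertwiners X Y) :=
  ⟨fun _ _ h => Hom.ext (congrArg Subtype.val h), fun T => ⟨⟨T.1, T.2⟩, rfl⟩⟩

end URep

section InducedTrivial

variable {G : Type u} [Group G] [TopologicalSpace G] [IsTopologicalGroup G]
  [LocallyCompactSpace G] {H : Subgroup G}
  [IsClosed (H : Set G)] [MeasurableSpace (G ⧸ H)] [BorelSpace (G ⧸ H)]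
  {Q : QuasiInvariantMeasure H}

open UniformSpace

theorem PreInduced.norm_completion_map_le {X Y : URep H} (T : URep.Hom X Y)
    (v : Completion (PreInduced Q X)) :
    ‖(PreInduced.map (Q := Q) T).completion v‖ ≤ ‖T.toCLM‖ * ‖v‖ := by
  induction v using UniformSpace.Completion.induction_on with
  | hp =>
    exact isClosed_le (PreInduced.map (Q := Q) T).completion.continuous.norm
      (continuous_const.mul continuous_norm)
  | ih f =>
    rw [ContinuousLinearMap.completion_apply_coe, Completion.norm_coe, Completion.norm_coe]
    exact (PreInduced.map (Q := Q) T).le_of_opNorm_le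
      (LinearMap.mkContinuous_norm_le _ (norm_nonneg _) _) f

theorem PreInduced.completion_map_add {X Y : URep H} (S T U : URep.Hom X Y)
    (h : U.toCLM = S.toCLM + T.toCLM) :
    (PreInduced.map (Q := Q) U).completion =
      (PreInduced.map (Q := Q) S).completion + (PreInduced.map (Q := Q) T).completion := by
  ext v
  induction v using UniformSpace.Completion.induction_on with
  | hp => exact isClosed_eq (ContinuousLinearMap.continuous _) (ContinuousLinearMap.continuous _)
  | ih f =>
    rw [add_apply, ContinuousLinearMap.completion_apply_coe,
      ContinuousLinearMap.completion_apply_coe, ContinuousLinearMap.completion_apply_coe,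
      ← Completion.coe_add]
    congr 1
    refine Subtype.ext (funext fun x => ?_)
    change U.toCLM (f.1 x) = S.toCLM (f.1 x) + T.toCLM (f.1 x)
    rw [h]
    rfl

namespace URep

variable (Q)

theorem exists_card_le_of_isLeftAdjoint (h : (Ind Q).IsLeftAdjoint) :
    ∃ N : ℕ, ∀ S : Finset (Submodule ℂ (induced Q (trivial H)).V),
      IsOrthogonalSystem (induced Q (trivial H)) S → S.card ≤ N := by
  obtain ⟨R, ⟨adj⟩⟩ := h.exists_rightAdjoint
  let Y := induced Q (trivial H)
  let ε : Hom (induced Q (R.obj Y)) Y := adj.counit.app Y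
  let φ : invariants (R.obj Y) → Hom (trivial H) (R.obj Y) := fun v =>
    ⟨ofInvariant (R.obj Y) v, ofInvariant_mem v⟩
  let e : Hom (trivial H) (R.obj Y) → Hom Y Y := (adj.homEquiv (trivial H) Y).symm
  have he : ∀ T, (e T).toCLM = ε.toCLM ∘L (PreInduced.map (Q := Q) T).completion := fun T =>
    congrArg Hom.toCLM
      (adj.homEquiv_counit (X := trivial H) (Y := Y) (g := (T : trivial H ⟶ R.obj Y)))
  refine IsOrthogonalSystem.exists_card_le_of_bijective Y
    (fun v : invariants (R.obj Y) => (⟨(e (φ v)).toCLM, (e (φ v)).comm⟩ : intertwiners Y Y))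
    (fun v w => Subtype.ext ?_) ‖ε.toCLM‖ (fun v => ?_)
    ((bijective_homToIntertwiners Y Y).comp
      ((adj.homEquiv (trivial H) Y).symm.bijective.comp (bijective_homOfInvariant (R.obj Y))))
  · change (e (φ (v + w))).toCLM = (e (φ v)).toCLM + (e (φ w)).toCLM
    rw [he, he, he, PreInduced.completion_map_add (φ v) (φ w) _ (map_add _ v w)]
    exact ContinuousLinearMap.comp_add ε.toCLM _ _
  · change ‖(e (φ v)).toCLM‖ ≤ _
    rw [he]
    refine ContinuousLinearMap.opNorm_le_bound _ (by positivity) fun x => ?_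
    rw [mul_assoc]
    refine ε.toCLM.le_opNorm_of_le ((PreInduced.norm_completion_map_le _ _).trans ?_)
    gcongr
    exact norm_ofInvariant_le v

theorem exists_card_le_of_isRightAdjoint (h : (Ind Q).IsRightAdjoint) :
    ∃ N : ℕ, ∀ S : Finset (Submodule ℂ (induced Q (trivial H)).V),
      IsOrthogonalSystem (induced Q (trivial H)) S → S.card ≤ N := by
  obtain ⟨L, ⟨adj⟩⟩ := h.exists_leftAdjoint
  let Y := induced Q (trivial H)
  let η : Hom Y (induced Q (L.obj Y)) := adj.unit.app Y
  let φ : invariants (L.obj Y) → Hom (L.obj Y) (trivial H) := fun v =>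
    ⟨toTrivial (L.obj Y) v, toTrivial_mem v⟩
  let e : Hom (L.obj Y) (trivial H) → Hom Y Y := adj.homEquiv Y (trivial H)
  have he : ∀ T, (e T).toCLM = (PreInduced.map (Q := Q) T).completion ∘L η.toCLM := fun T =>
    congrArg Hom.toCLM
      (adj.homEquiv_unit (X := Y) (Y := trivial H) (f := (T : L.obj Y ⟶ trivial H)))
  refine IsOrthogonalSystem.exists_card_le_of_bijective Y
    (fun v : invariants (L.obj Y) => (⟨(e (φ v)).toCLM, (e (φ v)).comm⟩ : intertwiners Y Y))
    (fun v w => Subtype.ext ?_) ‖η.toCLM‖ (fun v => ?_)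
    ((bijective_homToIntertwiners Y Y).comp
      ((adj.homEquiv Y (trivial H)).bijective.comp (bijective_homToTrivial (L.obj Y))))
  · change (e (φ (v + w))).toCLM = (e (φ v)).toCLM + (e (φ w)).toCLM
    rw [he, he, he, PreInduced.completion_map_add (φ v) (φ w) _ (map_add _ v w)]
    exact ContinuousLinearMap.add_comp _ _ η.toCLM
  · change ‖(e (φ v)).toCLM‖ ≤ _
    rw [he]
    refine ContinuousLinearMap.opNorm_le_bound _ (by positivity) fun x => ?_
    refine (PreInduced.norm_completion_map_le _ _).trans ?_
    calc ‖(φ v).toCLM‖ * ‖η.toCLM x‖ ≤ ‖v‖ * (‖η.toCLM‖ * ‖x‖) :=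
          mul_le_mul (norm_toTrivial_le v) (η.toCLM.le_opNorm x) (norm_nonneg _) (norm_nonneg _)
      _ = ‖η.toCLM‖ * ‖v‖ * ‖x‖ := by ring

end URep

namespace PreInduced

open URep

/-- The function on `G ⧸ H` given by a section of the trivial representation. -/
def toFunction (f : PreInduced Q (trivial H)) : G ⧸ H → ℂ :=
  fun p => trivialCoord H (f.1 p.out)

@[simp] theorem toFunction_mk (f : PreInduced Q (trivial H)) (x : G) :
    toFunction f (x : G ⧸ H) = trivialCoord H (f.1 x) := by
  obtain ⟨h, hh⟩ := QuotientGroup.mk_out_eq_mul H x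
  rw [toFunction, hh, f.2.2.1, trivial_ρ]

theorem continuous_toFunction (f : PreInduced Q (trivial H)) : Continuous (toFunction f) := by
  refine QuotientGroup.isOpenQuotientMap_mk.continuous_comp_iff.1 ?_
  have : toFunction f ∘ (QuotientGroup.mk : G → G ⧸ H) = fun x => trivialCoord H (f.1 x) :=
    funext (toFunction_mk f)
  rw [this]
  exact (trivialCoord H).continuous.comp f.2.1

theorem hasCompactSupport_toFunction (f : PreInduced Q (trivial H)) :
    HasCompactSupport (toFunction f) := by
  obtain ⟨K, hK, hfK⟩ := f.2.2.2
  refine HasCompactSupport.intro' hK.closure isClosed_closure fun p hp => ?_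
  induction p using QuotientGroup.induction_on with
  | H x => rw [toFunction_mk, hfK x fun h => hp (subset_closure h), map_zero]

theorem memLp_toFunction (f : PreInduced Q (trivial H)) : MemLp (toFunction f) 2 Q.μ :=
  (continuous_toFunction f).memLp_of_hasCompactSupport (hasCompactSupport_toFunction f)

variable (Q) in
/-- Sections of the trivial representation as square-integrable functions. -/
def toLpIsometry : PreInduced Q (trivial H) →ₗᵢ[ℂ] Lp ℂ 2 Q.μ where
  toFun f := (memLp_toFunction f).toLp _
  map_add' f f' := by
    rw [← MemLp.toLp_add]
    congr 1
  map_smul' c f := by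
    rw [RingHom.id_apply, ← MemLp.toLp_const_smul]
    congr 1
  norm_map' f := by
    change ‖(memLp_toFunction f).toLp _‖ = ‖f‖
    rw [← sq_eq_sq₀ (norm_nonneg _) (norm_nonneg _), norm_sq_eq, Lp.norm_toLp,
      (memLp_toFunction f).eLpNorm_eq_integral_rpow_norm (by norm_num) (by norm_num),
      ENNReal.toReal_ofReal (by positivity)]
    have h2 : ∀ p, RCLike.re (sectionInner f f p) = ‖toFunction f p‖ ^ (2 : ℝ) := fun p => by
      induction p using QuotientGroup.induction_on with
      | H x =>
        rw [toFunction_mk, norm_trivialCoord, Real.rpow_two]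
        exact (InnerProductSpace.norm_sq_eq_re_inner (𝕜 := ℂ) (f.1 x)).symm
    simp only [h2, ENNReal.toReal_ofNat]
    rw [← Real.rpow_natCast, ← Real.rpow_mul (integral_nonneg fun p => by positivity)]
    norm_num

theorem toLpIsometry_apply (f : PreInduced Q (trivial H)) :
    toLpIsometry Q f = (memLp_toFunction f).toLp _ := rfl

theorem exists_toFunction_eq {k : G ⧸ H → ℂ} (hk : Continuous k) (hs : HasCompactSupport k) :
    ∃ f : PreInduced Q (trivial H), toFunction f = k := by
  refine ⟨⟨fun x => k (x : G ⧸ H) • trivialOne H, ?_, fun x h => ?_, tsupport k, hs,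
    fun x hx => ?_⟩, funext fun p => ?_⟩
  · exact (hk.comp QuotientGroup.continuous_mk).smul continuous_const
  · change k ((x * h : G) : G ⧸ H) • trivialOne H = k (x : G ⧸ H) • trivialOne H
    rw [QuotientGroup.mk_mul_of_mem x h.2]
  · change k (x : G ⧸ H) • trivialOne H = 0
    rw [image_eq_zero_of_notMem_tsupport hx, zero_smul]
  · induction p using QuotientGroup.induction_on with
    | H x =>
      refine (toFunction_mk _ x).trans ?_
      change trivialCoord H (k (x : G ⧸ H) • trivialOne H) = k (x : G ⧸ H)
      rw [map_smul, trivialCoord_one, smul_eq_mul, mul_one]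

theorem toFunction_act (g : G) (f : PreInduced Q (trivial H)) :
    toFunction (act g f) = Q.translate g (toFunction f) := by
  ext p
  induction p using QuotientGroup.induction_on with
  | H x =>
    rw [toFunction_mk, act_apply, map_smul, QuasiInvariantMeasure.translate]
    change _ = _ * toFunction f ((g⁻¹ * x : G) : G ⧸ H)
    rw [toFunction_mk, smul_eq_mul]

theorem toLpIsometry_act (g : G) (f : PreInduced Q (trivial H)) :
    toLpIsometry Q (act g f) = Q.translateLp g (toLpIsometry Q f) := by
  rw [toLpIsometry_apply, toLpIsometry_apply, Q.translateLp_toLp]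
  congr 1
  exact toFunction_act g f

theorem denseRange_toLpIsometry : DenseRange (toLpIsometry Q) := by
  rw [DenseRange, Metric.dense_iff]
  intro v r hr
  obtain ⟨k, hkv, hks, hkc, hk⟩ := Q.exists_compactSupport_approx (Lp.memLp v)
    (ε := ENNReal.ofReal (r / 2)) (by simpa using hr)
  obtain ⟨f, rfl⟩ := exists_toFunction_eq (Q := Q) hkc hks
  refine ⟨toLpIsometry Q f, ?_, f, rfl⟩
  have h1 : dist v (toLpIsometry Q f) ≤ r / 2 := by
    rw [toLpIsometry_apply]
    conv_lhs => rw [← Lp.toLp_coeFn v (Lp.memLp v)]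
    rw [dist_eq_norm, ← MemLp.toLp_sub, Lp.norm_toLp]
    exact ENNReal.toReal_le_of_le_ofReal (by positivity) hkv
  rw [Metric.mem_ball, dist_comm]
  linarith

end PreInduced

/-- The representation induced from the trivial representation is the quasi-regular one. -/
theorem URep.unitaryEquiv_induced_trivial (Q : QuasiInvariantMeasure H) :
    UnitaryEquiv (induced Q (trivial H)) Q.quasiRegular := by
  let e := Completion.toComplL (𝕜 := ℂ) (E := PreInduced Q (trivial H))
  let B : Completion (PreInduced Q (trivial H)) →L[ℂ] Lp ℂ 2 Q.μ :=
    (PreInduced.toLpIsometry Q).toContinuousLinearMap.extend e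
  have hB : ∀ f : PreInduced Q (trivial H), B f = PreInduced.toLpIsometry Q f := fun f =>
    ContinuousLinearMap.extend_eq _ (e := e) Completion.denseRange_coe
      (Completion.isUniformInducing_coe _) f
  let A : Completion (PreInduced Q (trivial H)) →ₗᵢ[ℂ] Lp ℂ 2 Q.μ :=
    { toLinearMap := B.toLinearMap
      norm_map' := fun v => by
        change ‖B v‖ = ‖v‖
        induction v using UniformSpace.Completion.induction_on with
        | hp => exact isClosed_eq B.continuous.norm continuous_norm
        | ih f => rw [hB, Completion.norm_coe, LinearIsometry.norm_map] }
  have hsurj : Function.Surjective A := by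
    rw [← Set.range_eq_univ, ← A.isometry.isClosedEmbedding.isClosed_range.closure_eq]
    refine Set.eq_univ_of_univ_subset ?_
    rw [← (PreInduced.denseRange_toLpIsometry (Q := Q)).closure_range]
    refine closure_mono ?_
    rintro _ ⟨f, rfl⟩
    exact ⟨f, hB f⟩
  refine ⟨LinearIsometryEquiv.ofSurjective A hsurj, fun g v => ?_⟩
  change B (completionAct Q (trivial H) g v) = Q.translateLp g (B v)
  change Completion (PreInduced Q (trivial H)) at v
  induction v using UniformSpace.Completion.induction_on with
  | hp =>
    exact isClosed_eq (B.continuous.comp (completionAct Q _ g).continuous)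
      ((Q.translateLp g).continuous.comp B.continuous)
  | ih f => rw [completionAct_coe, hB, hB, PreInduced.toLpIsometry_act]

end InducedTrivial

end

theorem mainTheorem7 {G : Type u} [Group G] [TopologicalSpace G] [IsTopologicalGroup G]
    [LocallyCompactSpace G] [T2Space G] (H : Subgroup G) [IsClosed (H : Set G)] :
    (∀ [MeasurableSpace (G ⧸ H)] [BorelSpace (G ⧸ H)] (Q : QuasiInvariantMeasure H),
      (URep.Ind Q).IsLeftAdjoint ∨ (URep.Ind Q).IsRightAdjoint →
        ∃ (n : ℕ) (Y : Fin n → URep G), (∀ i, (Y i).IsIrreducible) ∧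
          URep.UnitaryEquiv Q.quasiRegular (URep.directSum Y)) ∧
    ((URep.Res H).IsLeftAdjoint ∨ (URep.Res H).IsRightAdjoint →
      ∑' Y : URep.Dual G, (URep.Dual.fixedDim H Y : ℝ≥0∞) < ⊤) := by
  refine ⟨fun Q h => ?_, fun h => ?_⟩
  · obtain ⟨N, hN⟩ := h.elim (URep.exists_card_le_of_isLeftAdjoint Q)
      (URep.exists_card_le_of_isRightAdjoint Q)
    obtain ⟨n, Z, hZ, hU⟩ := URep.exists_unitaryEquiv_directSum _ N hN
    exact ⟨n, Z, hZ, (URep.unitaryEquiv_induced_trivial Q).symm.trans hU⟩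
  · obtain ⟨W, ξ, hW⟩ := h.elim (URep.exists_isUniversalFixedVector_of_isLeftAdjoint H)
      (URep.exists_isUniversalFixedVector_of_isRightAdjoint H)
    exact hW.tsum_fixedDim_lt_top
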